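/- Let all random elements be defined on one probability space $(\Omega,\mathcal A,\mathbb P)$. For each $n\ge 2$ let $p=p_n\ge 2$ be an integer, put $\gamma_n=p/n$, and consider the linear model $$y=X\beta+u,\qquad X=Z\Sigma_n^{1/2},$$ where $\Sigma_n$ is a $p\times p$ symmetric positive semidefinite matrix, $\Sigma_n^{1/2}$ is its unique symmetric positive semidefinite square root, $Z=Z_n=(z_{ij})$ is a random $n\times p$ matrix, $\beta=\beta_n$ is a random vector in $\mathbb R^p$ and $u=u_n$ is a random vector in $\mathbb R^n$. For a symmetric $p\times p$ matrix $A$ with eigenvalues $s_1(A),\dots,s_p(A)$ write $F_A(x)=p^{-1}\#\{i: s_i(A)\le x\}$. Assume: (A1) $\gamma_n\to\gamma\in(0,\infty)$ as $n\to\infty$. (A2) The eigenvalues of the matrices $\Sigma_n$ are bounded from above uniformly in $n$, and $F_{\Sigma_n}(0)\ne 1$ for every $n$. (A3) For each $n$ the entries $z_{ij}$ of $Z_n$ are independent (not necessarily identically distributed) real random variables with $\mathbb E(z_{ij})=0$, $\mathbb E(z_{ij}^2)=1$ and distributions absolutely continuous with respect to Lebesgue measure, and for some $\varepsilon>0$,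 $\sup_n\max_{i,j}\mathbb E(|z_{ij}|^{4+\varepsilon})<\infty$. (A4) $F_{\Sigma_n}$ converges weakly, as $n\to\infty$, to a cumulative distribution function $H$ of a probability measure supported on $[0,\infty)$, and $H(0)\ne 1$. (A5) For each $n$, $\beta$ has independent entries with $\mathbb E(\beta_i)=0$, $\mathbb E(\beta_i^2)=\tau^2/p$ for some $\tau>0$ independent of $n$, and $\sup_n\max_i p^2\,\mathbb E(\beta_i^4)<\infty$; $u$ has independent entries with $\mathbb E(u_i)=0$, $\mathbb E(u_i^2)=\sigma^2$ for some $\sigma>0$ independent of $n$, and $\sup_n\max_i\mathbb E(u_i^4)<\infty$; and $u$, $Z$ and $\beta$ are jointly independent for every $n$. Let $\hat\Sigma_n=n^{-1}X^\top X$, $\hat m_1=\frac1p\operatorname{tr}(\hat\Sigma_n)$, $\hat m_2=\frac1p\operatorname{tr}(\hat\Sigma_n^2)$, $\tilde m_2=\hat m_2-\gamma_n\hat m_1^2$, and, where $\tilde m_2>0$, $$\hat\tau_n^2=\frac{1}{\tilde m_2}\frac{\|X^\top y\|_2^2}{n^2}-\frac{\gamma_n\hat m_1}{\tilde m_2}\frac{\|y\|_2^2}{n},\qquad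 \hat\sigma_n^2=\frac{\|y\|_2^2}{n}\Bigl(1+\gamma_n\frac{\hat m_1^2}{\tilde m_2}\Bigr)-\frac{\|X^\top y\|_2^2}{n^2}\frac{\hat m_1}{\tilde m_2}.$$ Then for every $n\ge 2$ one has $\tilde m_2>0$ almost surely, so that the estimators are almost surely well defined, and, as $n\to\infty$, $$\hat\sigma_n^2\overset{\mathbb P}{\longrightarrow}\sigma^2>0\qquad\text{and}\qquad\hat\tau_n^2\overset{\mathbb P}{\longrightarrow}\tau^2>0.$$ -/

import Mathlib

open MeasureTheory ProbabilityTheory Filter Topology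

/-- The eigenvalues of a real square matrix, counted with multiplicity. (For the symmetric matrices
to which this is applied, all complex roots of the characteristic polynomial are real.) -/
noncomputable def eigs {p : ℕ} (A : Matrix (Fin p) (Fin p) ℝ) : Multiset ℝ :=
  A.charpoly.roots

open scoped Classical in
/-- The empirical spectral distribution function `F_A(x) = p⁻¹ * #{i | s_i(A) ≤ x}`. -/
noncomputable def empSpecDist {p : ℕ} (A : Matrix (Fin p) (Fin p) ℝ) (x : ℝ) : ℝ :=
  ((eigs A).countP (fun s => s ≤ x) : ℝ) / p

open scoped MatrixOrder in
/-- The unique positive semidefinite square root of a positive semidefinite matrix. -/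
noncomputable def psdSqrt {p : ℕ} (A : Matrix (Fin p) (Fin p) ℝ) : Matrix (Fin p) (Fin p) ℝ :=
  CFC.sqrt A

/-- The squared Euclidean norm of a vector. -/
def sqNorm {k : ℕ} (v : Fin k → ℝ) : ℝ := ∑ i, v i ^ 2

/-- The design matrix `X = Z Σ^{1/2}`. -/
noncomputable def design {n p : ℕ} (Z : Fin n → Fin p → ℝ) (S : Matrix (Fin p) (Fin p) ℝ) :
    Matrix (Fin n) (Fin p) ℝ :=
  Matrix.of Z * psdSqrt S

/-- The response of the linear model, `y = X β + u`. -/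
def response {n p : ℕ} (X : Matrix (Fin n) (Fin p) ℝ) (β : Fin p → ℝ) (u : Fin n → ℝ) :
    Fin n → ℝ :=
  X.mulVec β + u

section Estimators

variable {n p : ℕ} (X : Matrix (Fin n) (Fin p) ℝ) (y : Fin n → ℝ)

/-- The sample covariance matrix `n⁻¹ Xᵀ X`. -/
noncomputable def sampleCov : Matrix (Fin p) (Fin p) ℝ :=
  (n : ℝ)⁻¹ • (X.transpose * X)

/-- `m̂₁ = p⁻¹ tr Σ̂`. -/
noncomputable def mHat1 : ℝ := (1 / (p : ℝ)) * (sampleCov X).trace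

/-- `m̂₂ = p⁻¹ tr Σ̂²`. -/
noncomputable def mHat2 : ℝ := (1 / (p : ℝ)) * (sampleCov X ^ 2).trace

/-- `m̃₂ = m̂₂ - (p / n) m̂₁²`. -/
noncomputable def mTilde2 : ℝ := mHat2 X - ((p : ℝ) / n) * mHat1 X ^ 2

/-- The estimator of the signal strength (meaningful when `m̃₂ > 0`). -/
noncomputable def tauSqHat : ℝ :=
  1 / mTilde2 X * (sqNorm (X.transpose.mulVec y) / (n : ℝ) ^ 2)
    - ((p : ℝ) / n) * mHat1 X / mTilde2 X * (sqNorm y / n)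

/-- The estimator of the noise variance (meaningful when `m̃₂ > 0`). -/
noncomputable def sigmaSqHat : ℝ :=
  sqNorm y / n * (1 + ((p : ℝ) / n) * (mHat1 X ^ 2 / mTilde2 X))
    - sqNorm (X.transpose.mulVec y) / (n : ℝ) ^ 2 * (mHat1 X / mTilde2 X)

end Estimators

/-! Write `G = X Xᵀ`, whose entries are the forms `zᵢᵀ Σ zⱼ` in the rows of `Z`. Given the design,
`y = [1, p^{-1/2} X] w`, where `w` stacks the noise `u` and `√p β` and has independent centered
coordinates. Hence `‖y‖²/n` and `‖Xᵀy‖²/n²` are quadratic forms in `w`, with conditional means `σ² +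
τ² m̂₁` and `σ² γₙ m̂₁ + τ² m̂₂`. The estimators solve this 2×2 linear system, whose determinant is
`m̃₂`. Their errors are therefore combinations of the two deviations, with coefficients bounded as
soon as `m̂₁` is bounded and `m̃₂` stays away from zero.

Deviations. The variance of a quadratic form is at most a constant times the squared Frobenius norm
of its matrix (`integral_quadForm_sq_le`). For both statistics this reduces to `1/n + tr G⁴ / n⁶`.
No operator norm bound on `X` is used: `G` is split into its diagonal and off-diagonal parts.
Diagonal entries stay close to `tr Σ = O(p)`. Off the diagonal, the fourth moment is a sum over
cycles `i, j, k, l`. Cycles with `i = k` or `j = l` number `O(n³)` and cost `O(p²)` each. Cycles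
with four distinct indices contract to `‖Σ²‖² = O(p)` (`integral_rowForm_cycle`). So `tr G⁴ = o(n⁶)`
in probability.

Determinant. By Cauchy-Schwarz on the diagonal, `n² p m̃₂` is at least the off-diagonal part of
`‖G‖²` (`sum_sq_offDiag_le_mTilde2`). That part has mean `n(n-1)‖Σ‖²` and variance `O(n³p²)`, while
`H(0) ≠ 1` forces `‖Σ‖² ≥ c p` eventually. Almost sure positivity for fixed `n` needs only one
nonzero off-diagonal entry: `z₀ᵀ Σ z₁` is, given `z₀`, a nontrivial linear form in variables with
densities. -/

set_option linter.unusedSectionVars false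
set_option linter.unusedVariables false

/-! ### Independence: Fubini, rows of a random matrix, linear forms with densities -/

section Independence

variable {Ω : Type*} [MeasurableSpace Ω] {P : Measure Ω} [IsProbabilityMeasure P]

/-- Fubini's theorem for independent random elements. -/
theorem ProbabilityTheory.IndepFun.lintegral_eq_lintegral_lintegral {α γ : Type*}
    [MeasurableSpace α] [MeasurableSpace γ] {X : Ω → α} {Y : Ω → γ} (h : IndepFun X Y P)
    (hX : Measurable X) (hY : Measurable Y) {f : α × γ → ENNReal} (hf : Measurable f) :
    ∫⁻ ω, f (X ω, Y ω) ∂P = ∫⁻ ω', ∫⁻ ω, f (X ω, Y ω') ∂P ∂P := by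
  have hmap := (indepFun_iff_map_prod_eq_prod_map_map hX.aemeasurable hY.aemeasurable).1 h
  have := Measure.isProbabilityMeasure_map (μ := P) hX.aemeasurable
  have := Measure.isProbabilityMeasure_map (μ := P) hY.aemeasurable
  rw [← lintegral_map (f := f) hf (hX.prodMk hY), hmap, lintegral_prod_symm' _ hf,
    lintegral_map hf.lintegral_prod_left' hY]
  refine lintegral_congr fun ω' => ?_
  exact lintegral_map (f := fun x => f (x, Y ω')) (by fun_prop) hX

/-- If `X` and `Y` are independent and each section `{X ∈ A_y}` is null, then so is `{X ∈ A_Y}`. -/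
theorem ProbabilityTheory.IndepFun.measure_eq_zero_of_forall {α γ : Type*}
    [MeasurableSpace α] [MeasurableSpace γ] {X : Ω → α} {Y : Ω → γ} (h : IndepFun X Y P)
    (hX : Measurable X) (hY : Measurable Y) {A : Set (α × γ)} (hA : MeasurableSet A)
    (h0 : ∀ᵐ ω' ∂P, P {ω | (X ω, Y ω') ∈ A} = 0) : P {ω | (X ω, Y ω) ∈ A} = 0 := by
  have h1 := h.lintegral_eq_lintegral_lintegral hX hY (f := A.indicator 1)
    (measurable_one.indicator hA)
  have e1 : ∫⁻ ω, A.indicator 1 (X ω, Y ω) ∂P = P {ω | (X ω, Y ω) ∈ A} := by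
    exact lintegral_indicator_one (μ := P) ((hX.prodMk hY) hA)
  have e2 : ∀ ω', ∫⁻ ω, A.indicator 1 (X ω, Y ω') ∂P = P {ω | (X ω, Y ω') ∈ A} := by
    intro ω'
    exact lintegral_indicator_one (μ := P) ((hX.prodMk (measurable_const (a := Y ω'))) hA)
  rw [← e1, h1, lintegral_congr e2]
  exact lintegral_eq_zero_of_ae_eq_zero h0

/-- If all entries of a random matrix are independent, so are its rows. -/
theorem ProbabilityTheory.iIndepFun.rows {ι κ : Type*} {Z : Ω → ι → κ → ℝ}
    (hZ : ∀ i j, Measurable fun ω => Z ω i j)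
    (h : iIndepFun (fun (ij : ι × κ) ω => Z ω ij.1 ij.2) P) :
    iIndepFun (fun i ω => Z ω i) P := by
  have : ∀ i j, IsProbabilityMeasure (P.map (fun ω => Z ω i j)) :=
    fun i j ↦ Measure.isProbabilityMeasure_map (hZ i j).aemeasurable
  have h2 : ∀ i, iIndepFun (fun j ω => Z ω i j) P := fun i =>
    h.precomp (g := fun j => (i, j)) (fun a b hab => by simpa using hab)
  have h3 : iIndepFun (fun (q : (_ : ι) × κ) ω => Z ω q.1 q.2) P :=
    h.precomp (Equiv.sigmaEquivProd ι κ).injective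
  -- Independence means that the joint law is a product measure; currying the index pair turns the
  -- product over entries into a product over rows of the row laws.
  rw [iIndepFun_iff_map_fun_eq_infinitePi_map (by fun_prop)] at h3 ⊢
  have e : (MeasurableEquiv.piCurry (fun (_ : ι) (_ : κ) => ℝ)) ∘ (fun ω q ↦ Z ω q.1 q.2)
      = fun ω i j ↦ Z ω i j := by
    ext; simp [Sigma.curry]
  change P.map (fun ω i j ↦ Z ω i j) = _
  rw [← e, ← Measure.map_map (by fun_prop) (by fun_prop), h3,
    Measure.infinitePi_map_piCurry (fun i j ↦ P.map (fun ω => Z ω i j))]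
  congr 1
  funext i
  rw [(iIndepFun_iff_map_fun_eq_infinitePi_map (by fun_prop)).1 (h2 i)]

/-- Two independent families of independent random variables form one independent family. -/
theorem ProbabilityTheory.iIndepFun.sumElim {ι κ : Type*} [Finite ι] [Finite κ]
    {U : ι → Ω → ℝ} {V : κ → Ω → ℝ}
    (hU : iIndepFun U P) (hV : iIndepFun V P)
    (h : IndepFun (fun ω i => U i ω) (fun ω i => V i ω) P) : iIndepFun (Sum.elim U V) P := by
  classical
  rw [iIndepFun_iff_measure_inter_preimage_eq_mul]
  intro S sets hsets
  have hsplit : (⋂ i ∈ S, Sum.elim U V i ⁻¹' sets i) =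
      ((fun ω i => U i ω) ⁻¹' {x | ∀ i ∈ S.toLeft, x i ∈ sets (Sum.inl i)}) ∩
      ((fun ω i => V i ω) ⁻¹' {x | ∀ i ∈ S.toRight, x i ∈ sets (Sum.inr i)}) := by
    ext ω
    simp [Sum.forall]
  have hmL : MeasurableSet {x : ι → ℝ | ∀ i ∈ S.toLeft, x i ∈ sets (Sum.inl i)} := by
    have : {x : ι → ℝ | ∀ i ∈ S.toLeft, x i ∈ sets (Sum.inl i)} =
      ⋂ i ∈ S.toLeft, (fun x : ι → ℝ => x i) ⁻¹' sets (Sum.inl i) := by ext; simp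
    rw [this]
    exact Finset.measurableSet_biInter _ fun i hi =>
      measurable_pi_apply i (hsets _ (by simpa using hi))
  have hmR : MeasurableSet {x : κ → ℝ | ∀ i ∈ S.toRight, x i ∈ sets (Sum.inr i)} := by
    have : {x : κ → ℝ | ∀ i ∈ S.toRight, x i ∈ sets (Sum.inr i)} =
      ⋂ i ∈ S.toRight, (fun x : κ → ℝ => x i) ⁻¹' sets (Sum.inr i) := by ext; simp
    rw [this]
    exact Finset.measurableSet_biInter _ fun i hi =>
      measurable_pi_apply i (hsets _ (by simpa using hi))
  rw [hsplit, h.measure_inter_preimage_eq_mul _ _ hmL hmR]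
  have eL : ((fun ω i => U i ω) ⁻¹' {x | ∀ i ∈ S.toLeft, x i ∈ sets (Sum.inl i)}) =
      ⋂ i ∈ S.toLeft, U i ⁻¹' sets (Sum.inl i) := by ext; simp
  have eR : ((fun ω i => V i ω) ⁻¹' {x | ∀ i ∈ S.toRight, x i ∈ sets (Sum.inr i)}) =
      ⋂ i ∈ S.toRight, V i ⁻¹' sets (Sum.inr i) := by ext; simp
  rw [eL, eR, hU.measure_inter_preimage_eq_mul S.toLeft (fun i hi => hsets _ (by simpa using hi)),
    hV.measure_inter_preimage_eq_mul S.toRight (fun i hi => hsets _ (by simpa using hi))]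
  conv_rhs => rw [← S.toLeft_disjSum_toRight, Finset.prod_disjSum]
  rfl

/-- A nontrivial linear form in independent random variables with absolutely continuous laws does
not vanish, almost surely. -/
theorem measure_linearForm_eq_zero {ι : Type*} [Fintype ι] {ξ : ι → Ω → ℝ}
    (hm : ∀ i, Measurable (ξ i)) (hind : iIndepFun ξ P)
    (hac : ∀ i, P.map (ξ i) ≪ volume) {v : ι → ℝ} (hv : v ≠ 0) :
    P {ω | ∑ i, v i * ξ i ω = 0} = 0 := by
  classical
  obtain ⟨i, hi⟩ := Function.ne_iff.1 hv
  have hi2 := hind.indepFun_finset {i} (Finset.univ.erase i) (by simp) hm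
  have h3 : IndepFun (ξ i) (fun ω => ∑ j ∈ Finset.univ.erase i, v j * ξ j ω) P := by
    have hφ : Measurable fun x : ↥({i} : Finset ι) → ℝ => x ⟨i, by simp⟩ := measurable_pi_apply _
    have := hi2.comp hφ
      (ψ := fun x : ↥(Finset.univ.erase i) → ℝ => ∑ j : ↥(Finset.univ.erase i), v j * x j)
      (by fun_prop)
    have e : (fun ω => ∑ j ∈ Finset.univ.erase i, v j * ξ j ω) =
        fun ω => ∑ j : ↥(Finset.univ.erase i), v j * ξ j ω :=
      funext fun ω => (Finset.sum_coe_sort (Finset.univ.erase i) (fun j => v j * ξ j ω)).symm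
    rw [e]
    exact this
  -- With the other coordinates frozen, the event confines `ξ i` to the single point `-r / v i`,
  -- which is Lebesgue null.
  have h4 := h3.measure_eq_zero_of_forall (hm i)
    (Finset.measurable_sum _ fun j _ => (hm j).const_mul _)
    (A := {q | v i * q.1 + q.2 = 0})
    (measurableSet_eq_fun (by fun_prop) (by fun_prop)) (ae_of_all _ fun ω' => by
      set r := ∑ j ∈ Finset.univ.erase i, v j * ξ j ω'
      have : {ω | (ξ i ω, r) ∈ {q : ℝ × ℝ | v i * q.1 + q.2 = 0}} = ξ i ⁻¹' {-r / v i} := by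
        ext ω
        have hi' : v i ≠ 0 := hi
        simp only [Set.mem_ofPred_eq, Set.mem_preimage, Set.mem_singleton_iff]
        rw [eq_div_iff hi']
        constructor <;> intro h <;> linarith
      rw [this, ← Measure.map_apply (hm i) (measurableSet_singleton _)]
      exact hac i (by simp))
  convert h4 using 2
  ext ω
  simp only [Set.mem_ofPred_eq]
  rw [← Finset.add_sum_erase _ _ (Finset.mem_univ i)]

end Independence

/-! ### Moments of linear and quadratic forms in independent variables -/

section Moments

variable {Ω : Type*} [MeasurableSpace Ω] {P : Measure Ω} [IsProbabilityMeasure P]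

theorem memLp_four_iff_integrable_pow {f : Ω → ℝ} (hf : AEStronglyMeasurable f P) :
    MemLp f 4 P ↔ Integrable (fun ω => f ω ^ 4) P := by
  rw [← integrable_norm_rpow_iff hf (by norm_num) (by norm_num)]
  have : (fun ω => ‖f ω‖ ^ ((4 : ENNReal).toReal)) = fun ω => f ω ^ 4 := by
    ext ω
    rw [show ((4 : ENNReal).toReal) = ((4 : ℕ) : ℝ) by norm_num, Real.rpow_natCast,
      Real.norm_eq_abs, Even.pow_abs (by decide)]
  rw [this]

theorem MeasureTheory.MemLp.integrable_pow_four {f : Ω → ℝ} (hf : MemLp f 4 P) :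
    Integrable (fun ω => f ω ^ 4) P :=
  (memLp_four_iff_integrable_pow hf.1).1 hf

/-- AM-GM applied twice. Through it, a product of four variables is controlled by their separate
fourth moments, whatever their dependence. -/
theorem mul_four_abs_le (a b c d : ℝ) :
    |a * b * c * d| ≤ (a ^ 4 + b ^ 4 + c ^ 4 + d ^ 4) / 4 := by
  rw [abs_le]
  constructor <;>
  nlinarith [sq_nonneg (a * b + c * d), sq_nonneg (a * b - c * d), sq_nonneg (a ^ 2 - b ^ 2),
    sq_nonneg (c ^ 2 - d ^ 2)]

theorem integrable_mul_four {a b c d : Ω → ℝ} (ha : MemLp a 4 P) (hb : MemLp b 4 P)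
    (hc : MemLp c 4 P) (hd : MemLp d 4 P) :
    Integrable (fun ω => a ω * b ω * c ω * d ω) P := by
  refine Integrable.mono' ((((ha.integrable_pow_four.add hb.integrable_pow_four).add
    hc.integrable_pow_four).add hd.integrable_pow_four).div_const 4)
    (((ha.1.mul hb.1).mul hc.1).mul hd.1) (ae_of_all _ fun ω => ?_)
  simpa using mul_four_abs_le (a ω) (b ω) (c ω) (d ω)

theorem memLp_two_of_four {a : Ω → ℝ} (ha : MemLp a 4 P) : MemLp a 2 P :=
  ha.mono_exponent (by norm_num)

theorem integrable_of_memLp_four {a : Ω → ℝ} (ha : MemLp a 4 P) : Integrable a P :=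
  ha.integrable (by norm_num)

theorem memLp_two_mul_of_four {a b : Ω → ℝ} (ha : MemLp a 4 P) (hb : MemLp b 4 P) :
    MemLp (fun ω => a ω * b ω) 2 P := by
  rw [memLp_two_iff_integrable_sq (f := fun ω => a ω * b ω) (ha.1.mul hb.1)]
  refine (integrable_mul_four ha ha hb hb).congr (ae_of_all _ fun ω => ?_)
  simp only
  ring

/-- Product rule for expectations of independent real random variables. -/
theorem integral_comp_mul_of_indepFun {α γ : Type*} [MeasurableSpace α] [MeasurableSpace γ]
    {X : Ω → α} {Y : Ω → γ} (h : IndepFun X Y P) (hX : Measurable X) (hY : Measurable Y)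
    {f : α → ℝ} {g : γ → ℝ} (hf : Measurable f) (hg : Measurable g) :
    ∫ ω, f (X ω) * g (Y ω) ∂P = (∫ ω, f (X ω) ∂P) * ∫ ω, g (Y ω) ∂P :=
  h.integral_fun_comp_mul_comp hX.aemeasurable hY.aemeasurable hf.aestronglyMeasurable
    hg.aestronglyMeasurable

/-- Fourth moment of a sum of two independent centered random variables. -/
theorem integral_add_pow_four {X Y : Ω → ℝ} (h : IndepFun X Y P) (hXm : Measurable X)
    (hYm : Measurable Y) (hX : MemLp X 4 P) (hY : MemLp Y 4 P) (hX0 : ∫ ω, X ω ∂P = 0)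
    (hY0 : ∫ ω, Y ω ∂P = 0) :
    ∫ ω, (X ω + Y ω) ^ 4 ∂P =
      ∫ ω, X ω ^ 4 ∂P + 6 * ((∫ ω, X ω ^ 2 ∂P) * ∫ ω, Y ω ^ 2 ∂P) + ∫ ω, Y ω ^ 4 ∂P := by
  have i0 := hX.integrable_pow_four
  have i4 := hY.integrable_pow_four
  have i1 : Integrable (fun ω => X ω ^ 3 * Y ω) P :=
    (integrable_mul_four hX hX hX hY).congr (ae_of_all _ fun ω => by simp only; ring)
  have i2 : Integrable (fun ω => X ω ^ 2 * Y ω ^ 2) P :=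
    (integrable_mul_four hX hX hY hY).congr (ae_of_all _ fun ω => by simp only; ring)
  have i3 : Integrable (fun ω => X ω * Y ω ^ 3) P :=
    (integrable_mul_four hX hY hY hY).congr (ae_of_all _ fun ω => by simp only; ring)
  have e1 := integral_comp_mul_of_indepFun h hXm hYm (f := fun x => x ^ 3) (g := fun x => x)
    (by fun_prop) (by fun_prop)
  have e2 := integral_comp_mul_of_indepFun h hXm hYm (f := fun x => x ^ 2) (g := fun x => x ^ 2)
    (by fun_prop) (by fun_prop)
  have e3 := integral_comp_mul_of_indepFun h hXm hYm (f := fun x => x) (g := fun x => x ^ 3)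
    (by fun_prop) (by fun_prop)
  have e : (fun ω => (X ω + Y ω) ^ 4) = fun ω => X ω ^ 4 + (4 * (X ω ^ 3 * Y ω) +
      (6 * (X ω ^ 2 * Y ω ^ 2) + (4 * (X ω * Y ω ^ 3) + Y ω ^ 4))) := by
    ext ω; ring
  rw [e, integral_add i0 ((i1.const_mul 4).fun_add ((i2.const_mul 6).fun_add ((i3.const_mul 4).fun_add i4))),
    integral_add (i1.const_mul 4) ((i2.const_mul 6).fun_add ((i3.const_mul 4).fun_add i4)),
    integral_add (i2.const_mul 6) ((i3.const_mul 4).fun_add i4),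
    integral_add (i3.const_mul 4) i4, integral_const_mul, integral_const_mul, integral_const_mul,
    e1, e2, e3, hX0, hY0]
  ring

/-- Independent centered random variables with uniformly bounded second and fourth moments. -/
structure IndepCentered {ι : Type*} (ξ : ι → Ω → ℝ) (P : Measure Ω) (M : ℝ) : Prop where
  meas : ∀ i, Measurable (ξ i)
  indep : iIndepFun ξ P
  memLp : ∀ i, MemLp (ξ i) 4 P
  mean : ∀ i, ∫ ω, ξ i ω ∂P = 0
  sq_le : ∀ i, ∫ ω, ξ i ω ^ 2 ∂P ≤ M
  pow_le : ∀ i, ∫ ω, ξ i ω ^ 4 ∂P ≤ M ^ 2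

namespace IndepCentered

variable {ι : Type*} {ξ : ι → Ω → ℝ} {M : ℝ}

theorem indepFun_finset_comp (h : IndepCentered ξ P M) {s : Finset ι} {i : ι} (hi : i ∉ s)
    {γ : Type*} [MeasurableSpace γ] {F : (s → ℝ) → γ} (hF : Measurable F) :
    IndepFun (fun ω => F (fun j => ξ j ω)) (ξ i) P := by
  have hψ : Measurable fun x : ↥({i} : Finset ι) → ℝ => x ⟨i, by simp⟩ := measurable_pi_apply _
  exact (h.indep.indepFun_finset s {i} (by simpa using hi) h.meas).comp hF hψ

theorem indepFun_sum (h : IndepCentered ξ P M) {s : Finset ι} {i : ι} (hi : i ∉ s) (v : ι → ℝ) :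
    IndepFun (fun ω => ∑ j ∈ s, v j * ξ j ω) (ξ i) P := by
  have := h.indepFun_finset_comp hi (F := fun x => ∑ j : s, v j * x j) (by fun_prop)
  have e : (fun ω => ∑ j ∈ s, v j * ξ j ω) = fun ω => ∑ j : s, v j * ξ j ω :=
    funext fun ω => (Finset.sum_coe_sort s (fun j => v j * ξ j ω)).symm
  rw [e]
  exact this

theorem measurable_sum (h : IndepCentered ξ P M) (s : Finset ι) (v : ι → ℝ) :
    Measurable (fun ω => ∑ j ∈ s, v j * ξ j ω) :=
  Finset.measurable_sum _ fun j _ => (h.meas j).const_mul _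

theorem memLp_sum (h : IndepCentered ξ P M) (s : Finset ι) (v : ι → ℝ) :
    MemLp (fun ω => ∑ j ∈ s, v j * ξ j ω) 4 P :=
  memLp_finsetSum _ fun j _ => (h.memLp j).const_mul _

theorem integral_sum (h : IndepCentered ξ P M) (s : Finset ι) (v : ι → ℝ) :
    ∫ ω, ∑ j ∈ s, v j * ξ j ω ∂P = 0 := by
  rw [integral_finsetSum _ fun j _ => (integrable_of_memLp_four (h.memLp j)).const_mul _]
  simp [integral_const_mul, h.mean]

theorem integral_sum_sq (h : IndepCentered ξ P M) (s : Finset ι) (v : ι → ℝ) :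
    ∫ ω, (∑ j ∈ s, v j * ξ j ω) ^ 2 ∂P = ∑ j ∈ s, v j ^ 2 * ∫ ω, ξ j ω ^ 2 ∂P := by
  classical
  induction s using Finset.induction_on with
  | empty => simp
  | insert i s hi ih =>
    have hS := h.memLp_sum s v
    have hind := h.indepFun_sum hi v
    have e1 := integral_comp_mul_of_indepFun hind (h.measurable_sum s v) (h.meas i)
      (f := fun x => x) (g := fun x => x) (by fun_prop) (by fun_prop)
    have i1 : Integrable (fun ω => (∑ j ∈ s, v j * ξ j ω) * ξ i ω) P :=
      (memLp_two_mul_of_four hS (h.memLp i)).integrable (by norm_num)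
    have i2 := (memLp_two_of_four hS).integrable_sq
    have i3 := (memLp_two_of_four (h.memLp i)).integrable_sq
    simp_rw [Finset.sum_insert hi]
    rw [← ih]
    have e : (fun ω => (v i * ξ i ω + ∑ j ∈ s, v j * ξ j ω) ^ 2) = fun ω =>
        v i ^ 2 * ξ i ω ^ 2 + (2 * v i * ((∑ j ∈ s, v j * ξ j ω) * ξ i ω) +
          (∑ j ∈ s, v j * ξ j ω) ^ 2) := by ext ω; ring
    rw [e, integral_add (i3.const_mul _) ((i1.const_mul _).fun_add i2),
      integral_add (i1.const_mul _) i2, integral_const_mul, integral_const_mul, e1, h.mean i]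
    ring

theorem integral_sum_sq_le (h : IndepCentered ξ P M) (s : Finset ι) (v : ι → ℝ) :
    ∫ ω, (∑ j ∈ s, v j * ξ j ω) ^ 2 ∂P ≤ M * ∑ j ∈ s, v j ^ 2 := by
  rw [h.integral_sum_sq, Finset.mul_sum]
  exact Finset.sum_le_sum fun j _ => by nlinarith [h.sq_le j, sq_nonneg (v j)]

/-- Fourth moments of linear forms. -/
theorem integral_sum_pow_four_le (h : IndepCentered ξ P M) (s : Finset ι) (v : ι → ℝ) :
    ∫ ω, (∑ j ∈ s, v j * ξ j ω) ^ 4 ∂P ≤ 3 * M ^ 2 * (∑ j ∈ s, v j ^ 2) ^ 2 := by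
  classical
  induction s using Finset.induction_on with
  | empty => simp
  | insert i s hi ih =>
    have hM : 0 ≤ M := (integral_nonneg fun ω => sq_nonneg (ξ i ω)).trans (h.sq_le i)
    have hind : IndepFun (fun ω => ∑ j ∈ s, v j * ξ j ω) (fun ω => v i * ξ i ω) P :=
      (h.indepFun_sum hi v).comp (φ := fun x => x) (ψ := fun x => v i * x)
        (by fun_prop) (by fun_prop)
    have key := integral_add_pow_four hind (h.measurable_sum s v) ((h.meas i).const_mul _)
      (h.memLp_sum s v) ((h.memLp i).const_mul _) (h.integral_sum s v)
      (by rw [integral_const_mul, h.mean, mul_zero])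
    simp_rw [Finset.sum_insert hi, add_comm (v i * ξ i _)]
    rw [key]
    simp_rw [mul_pow]
    rw [integral_const_mul, integral_const_mul]
    have h2 := h.integral_sum_sq_le s v
    set V := ∑ j ∈ s, v j ^ 2
    have hV : 0 ≤ V := Finset.sum_nonneg fun j _ => sq_nonneg _
    -- The constant 3 closes the induction: the cross term of `3 M² (V + vᵢ²)²` is `6 M² V vᵢ²`,
    -- exactly six times this bound.
    have h3 : (∫ ω, (∑ j ∈ s, v j * ξ j ω) ^ 2 ∂P) * (v i ^ 2 * ∫ ω, ξ i ω ^ 2 ∂P) ≤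
        (M * V) * (v i ^ 2 * M) := by
      refine mul_le_mul h2 (mul_le_mul_of_nonneg_left (h.sq_le i) (sq_nonneg _))
        (mul_nonneg (sq_nonneg _) (integral_nonneg fun ω => sq_nonneg _)) (by positivity)
    have h4 : v i ^ 4 * ∫ ω, ξ i ω ^ 4 ∂P ≤ v i ^ 4 * M ^ 2 :=
      mul_le_mul_of_nonneg_left (h.pow_le i) (by positivity)
    have h5 : 0 ≤ v i ^ 4 * M ^ 2 := by positivity
    nlinarith

/-- The variance of a quadratic form. -/
theorem integral_quadForm_sq_le (h : IndepCentered ξ P M) (A : ι → ι → ℝ)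
    (hA : ∀ i j, A i j = A j i) (s : Finset ι) :
    MemLp (fun ω => ∑ i ∈ s, ∑ j ∈ s, A i j * ξ i ω * ξ j ω
        - ∑ i ∈ s, A i i * ∫ ω, ξ i ω ^ 2 ∂P) 2 P ∧
    ∫ ω, (∑ i ∈ s, ∑ j ∈ s, A i j * ξ i ω * ξ j ω
        - ∑ i ∈ s, A i i * ∫ ω, ξ i ω ^ 2 ∂P) ^ 2 ∂P ≤
      8 * M ^ 2 * ∑ i ∈ s, ∑ j ∈ s, A i j ^ 2 := by
  classical
  induction s using Finset.induction_on with
  | empty => simp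
  | insert i s hi ih =>
    obtain ⟨ihm, ih⟩ := ih
    set m := ∫ ω, ξ i ω ^ 2 ∂P with hm
    have hm0 : 0 ≤ m := integral_nonneg fun ω => sq_nonneg _
    have hmM : m ≤ M := h.sq_le i
    have hM : 0 ≤ M := hm0.trans hmM
    set T : Ω → ℝ := fun ω => ∑ i ∈ s, ∑ j ∈ s, A i j * ξ i ω * ξ j ω
        - ∑ i ∈ s, A i i * ∫ ω, ξ i ω ^ 2 ∂P with hT
    set l : Ω → ℝ := fun ω => ∑ j ∈ s, A i j * ξ j ω with hl
    -- Independence of the pair is needed, since `T * E` contains both `T` and `l`.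
    have hTl : IndepFun (fun ω => (T ω, l ω)) (ξ i) P := by
      have := h.indepFun_finset_comp hi (F := fun x =>
        (∑ a : s, ∑ b : s, A a b * x a * x b - ∑ a ∈ s, A a a * ∫ ω, ξ a ω ^ 2 ∂P,
          ∑ j : s, A i j * x j)) (by fun_prop)
      convert this using 1
      ext ω
      · simp only [hT]
        rw [← Finset.sum_coe_sort s]
        simp_rw [← Finset.sum_coe_sort s (fun j => A _ j * ξ _ ω * ξ j ω)]
      · simp only [hl]
        exact (Finset.sum_coe_sort s (fun j => A i j * ξ j ω)).symm
    have hTm : Measurable T := by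
      have := h.meas
      fun_prop
    have hlm : Measurable l := h.measurable_sum s _
    have hTlm : Measurable (fun ω => (T ω, l ω)) := hTm.prodMk hlm
    have hl4 : MemLp l 4 P := h.memLp_sum s _
    -- Adjoining `i` adds a centered diagonal increment `D` and a cross increment `E`. Both have
    -- mean zero given the coordinates in `s`, so they are orthogonal to `T`, and the second moments
    -- of `T` and `D + E` add up.
    set D : Ω → ℝ := fun ω => A i i * (ξ i ω ^ 2 - m) with hD
    set E : Ω → ℝ := fun ω => 2 * (l ω * ξ i ω) with hE
    have hx2 : MemLp (fun ω => ξ i ω ^ 2) 2 P := by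
      simpa only [sq] using memLp_two_mul_of_four (h.memLp i) (h.memLp i)
    have hDL : MemLp D 2 P := (hx2.sub (memLp_const m)).const_mul _
    have hEL : MemLp E 2 P := (memLp_two_mul_of_four hl4 (h.memLp i)).const_mul _
    have e : ∀ ω, ∑ a ∈ insert i s, ∑ b ∈ insert i s, A a b * ξ a ω * ξ b ω
        - ∑ a ∈ insert i s, A a a * ∫ ω, ξ a ω ^ 2 ∂P = T ω + (D ω + E ω) := by
      intro ω
      simp only [hT, hD, hE, hl, Finset.sum_insert hi, Finset.sum_add_distrib]
      have : ∑ x ∈ s, A x i * ξ x ω * ξ i ω = ξ i ω * ∑ j ∈ s, A i j * ξ j ω := by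
        rw [Finset.mul_sum]
        exact Finset.sum_congr rfl fun x _ => by rw [hA x i]; ring
      rw [this]
      have : ∑ x ∈ s, A i x * ξ i ω * ξ x ω = ξ i ω * ∑ j ∈ s, A i j * ξ j ω := by
        rw [Finset.mul_sum]
        exact Finset.sum_congr rfl fun x _ => by ring
      rw [this]
      ring
    simp_rw [e]
    refine ⟨ihm.add (hDL.add hEL), ?_⟩
    have hTD : ∫ ω, T ω * D ω ∂P = 0 := by
      have := integral_comp_mul_of_indepFun hTl hTlm (h.meas i) (f := fun x => x.1)
        (g := fun x => A i i * (x ^ 2 - m)) (by fun_prop) (by fun_prop)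
      simp only at this
      rw [this, integral_const_mul, integral_sub (hx2.integrable (by norm_num))
        (integrable_const _)]
      simp [hm]
    have hTE : ∫ ω, T ω * E ω ∂P = 0 := by
      have := integral_comp_mul_of_indepFun hTl hTlm (h.meas i) (f := fun x => x.1 * x.2)
        (g := fun x => 2 * x) (by fun_prop) (by fun_prop)
      simp only [integral_const_mul, h.mean i, mul_zero] at this
      rw [← this]
      congr 1
      ext ω
      simp only [hE]
      ring
    have hT2 := ihm.integrable_sq
    have iTD : Integrable (fun ω => T ω * D ω) P := ihm.integrable_mul hDL
    have iTE : Integrable (fun ω => T ω * E ω) P := ihm.integrable_mul hEL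
    have iDE := (hDL.add hEL).integrable_sq
    have e2 : (fun ω => (T ω + (D ω + E ω)) ^ 2) = fun ω =>
        T ω ^ 2 + (2 * (T ω * D ω) + (2 * (T ω * E ω) + (D + E) ω ^ 2)) := by
      ext ω; simp only [Pi.add_apply]; ring
    rw [e2, integral_add hT2 ((iTD.const_mul _).fun_add ((iTE.const_mul _).fun_add iDE)),
      integral_add (iTD.const_mul _) ((iTE.const_mul _).fun_add iDE),
      integral_add (iTE.const_mul _) iDE, integral_const_mul, integral_const_mul, hTD, hTE]
    -- The constant 8 has room for this crude split: the increments cost at most `2 M² Aᵢᵢ² + 8 M² ∑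
    -- Aᵢⱼ²`, while the right side grows by `8 M² (Aᵢᵢ² + 2 ∑ Aᵢⱼ²)`.
    have hDE : ∫ ω, (D + E) ω ^ 2 ∂P ≤ 2 * ∫ ω, D ω ^ 2 ∂P + 2 * ∫ ω, E ω ^ 2 ∂P := by
      rw [← integral_const_mul, ← integral_const_mul,
        ← integral_add (hDL.integrable_sq.const_mul _) (hEL.integrable_sq.const_mul _)]
      refine integral_mono iDE ((hDL.integrable_sq.const_mul _).add
        (hEL.integrable_sq.const_mul _)) fun ω => ?_
      simp only [Pi.add_apply]
      nlinarith [sq_nonneg (D ω - E ω)]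
    have hD2 : ∫ ω, D ω ^ 2 ∂P ≤ A i i ^ 2 * M ^ 2 := by
      have : (fun ω => D ω ^ 2) = fun ω =>
          A i i ^ 2 * (ξ i ω ^ 4 + (-2 * m * ξ i ω ^ 2 + m ^ 2)) := by
        ext ω; simp only [hD]; ring
      have i2 : Integrable (fun ω => -2 * m * ξ i ω ^ 2) P :=
        (hx2.integrable (by norm_num)).const_mul _
      rw [this, integral_const_mul, integral_add (h.memLp i).integrable_pow_four
        (i2.fun_add (integrable_const _)), integral_add i2 (integrable_const _),
        integral_const_mul, ← hm]
      refine mul_le_mul_of_nonneg_left ?_ (sq_nonneg _)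
      have := h.pow_le i
      simp only [integral_const, probReal_univ, smul_eq_mul]
      nlinarith [sq_nonneg m]
    have hE2 : ∫ ω, E ω ^ 2 ∂P ≤ 4 * (M * ∑ j ∈ s, A i j ^ 2) * M := by
      have := integral_comp_mul_of_indepFun hTl hTlm (h.meas i) (f := fun x => 4 * x.2 ^ 2)
        (g := fun x => x ^ 2) (by fun_prop) (by fun_prop)
      have e3 : (fun ω => E ω ^ 2) = fun ω => 4 * l ω ^ 2 * ξ i ω ^ 2 := by
        ext ω; simp only [hE]; ring
      simp only at this
      rw [e3, this, integral_const_mul]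
      have := h.integral_sum_sq_le s (A i)
      exact mul_le_mul (mul_le_mul_of_nonneg_left this (by norm_num)) hmM hm0
        (mul_nonneg (by norm_num) (mul_nonneg hM (Finset.sum_nonneg fun j _ => sq_nonneg _)))
    have e4 : ∑ a ∈ insert i s, ∑ b ∈ insert i s, A a b ^ 2 =
        A i i ^ 2 + 2 * ∑ j ∈ s, A i j ^ 2 + ∑ a ∈ s, ∑ b ∈ s, A a b ^ 2 := by
      simp only [Finset.sum_insert hi, Finset.sum_add_distrib]
      have : ∑ x ∈ s, A x i ^ 2 = ∑ j ∈ s, A i j ^ 2 :=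
        Finset.sum_congr rfl fun x _ => by rw [hA x i]
      rw [this]; ring
    rw [e4]
    have h0 : 0 ≤ ∑ j ∈ s, A i j ^ 2 := Finset.sum_nonneg fun j _ => sq_nonneg _
    have h1 : 0 ≤ A i i ^ 2 * M ^ 2 := by positivity
    have h2 : 0 ≤ M ^ 2 * ∑ j ∈ s, A i j ^ 2 := by positivity
    nlinarith

end IndepCentered

end Moments

/-! ### Bilinear forms in the rows of `Z` -/

section RowForms

variable {Ω : Type*} [MeasurableSpace Ω] {P : Measure Ω} [IsProbabilityMeasure P]

/-- Conditional bounds for a nonnegative function of two independent random elements integrate. -/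
theorem ProbabilityTheory.IndepFun.integrable_and_integral_le {α γ : Type*}
    [MeasurableSpace α] [MeasurableSpace γ] {X : Ω → α} {Y : Ω → γ} (h : IndepFun X Y P)
    (hX : Measurable X) (hY : Measurable Y) {f : α × γ → ℝ} (hf : Measurable f)
    (hf0 : ∀ x, 0 ≤ f x) {G : Ω → ℝ} (hG : Integrable G P)
    (hfG : ∀ ω', Integrable (fun ω => f (X ω, Y ω')) P ∧ ∫ ω, f (X ω, Y ω') ∂P ≤ G ω') :
    Integrable (fun ω => f (X ω, Y ω)) P ∧ ∫ ω, f (X ω, Y ω) ∂P ≤ ∫ ω, G ω ∂P := by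
  have hG0 : ∀ ω, 0 ≤ G ω := fun ω => (integral_nonneg fun _ => hf0 _).trans (hfG ω).2
  have key : ∫⁻ ω, ENNReal.ofReal (f (X ω, Y ω)) ∂P ≤ ENNReal.ofReal (∫ ω, G ω ∂P) := by
    rw [h.lintegral_eq_lintegral_lintegral hX hY (f := fun x => ENNReal.ofReal (f x))
      hf.ennreal_ofReal, ofReal_integral_eq_lintegral_ofReal hG (ae_of_all _ hG0)]
    refine lintegral_mono fun ω' => ?_
    rw [← ofReal_integral_eq_lintegral_ofReal (hfG ω').1 (ae_of_all _ fun _ => hf0 _)]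
    exact ENNReal.ofReal_le_ofReal (hfG ω').2
  have hm : Measurable fun ω => f (X ω, Y ω) := hf.comp (hX.prodMk hY)
  have hi : Integrable (fun ω => f (X ω, Y ω)) P := by
    refine ⟨hm.aestronglyMeasurable, ?_⟩
    rw [hasFiniteIntegral_iff_ofReal (ae_of_all _ fun _ => hf0 _)]
    exact key.trans_lt ENNReal.ofReal_lt_top
  refine ⟨hi, ?_⟩
  rw [← ofReal_integral_eq_lintegral_ofReal hi (ae_of_all _ fun _ => hf0 _)] at key
  exact (ENNReal.ofReal_le_ofReal_iff (integral_nonneg hG0)).1 key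

namespace IndepCentered

variable {ι : Type*} {ξ : ι → Ω → ℝ} {M : ℝ}

theorem integral_mul_eq (h : IndepCentered ξ P M) (h1 : ∀ i, ∫ ω, ξ i ω ^ 2 ∂P = 1)
    [DecidableEq ι] (i j : ι) : ∫ ω, ξ i ω * ξ j ω ∂P = if i = j then 1 else 0 := by
  split_ifs with hij
  · subst hij
    simpa only [sq] using h1 i
  · have := integral_comp_mul_of_indepFun (h.indep.indepFun hij) (h.meas i) (h.meas j)
      (f := fun x => x) (g := fun x => x) (by fun_prop) (by fun_prop)
    rw [this, h.mean i, zero_mul]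

/-- Averaging a product of two linear forms with random coefficients over an independent isotropic
vector. -/
theorem integral_linForm_mul_linForm [Fintype ι] (h : IndepCentered ξ P M)
    (h1 : ∀ i, ∫ ω, ξ i ω ^ 2 ∂P = 1) {s t : ι → Ω → ℝ} {r : Ω → ℝ}
    (hs : ∀ i, MemLp (s i) 4 P) (ht : ∀ i, MemLp (t i) 4 P) (hr : MemLp r 2 P)
    (hsm : ∀ i, Measurable (s i)) (htm : ∀ i, Measurable (t i)) (hrm : Measurable r)
    (hind : IndepFun (fun ω => ((fun i => s i ω), (fun i => t i ω), r ω))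
      (fun ω i => ξ i ω) P) :
    ∫ ω, (∑ i, s i ω * ξ i ω) * (∑ i, t i ω * ξ i ω) * r ω ∂P =
      ∫ ω, (∑ i, s i ω * t i ω) * r ω ∂P := by
  classical
  have hst : ∀ i j, Integrable (fun ω => s i ω * t j ω * r ω) P := fun i j =>
    (memLp_two_mul_of_four (hs i) (ht j)).integrable_mul hr
  have hxx : ∀ i j, Integrable (fun ω => ξ i ω * ξ j ω) P := fun i j =>
    (memLp_two_mul_of_four (h.memLp i) (h.memLp j)).integrable (by norm_num)
  have hmeas := h.meas
  have hind' : ∀ i j, IndepFun (fun ω => s i ω * t j ω * r ω) (fun ω => ξ i ω * ξ j ω) P :=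
    fun i j => hind.comp
      (φ := fun x : (ι → ℝ) × (ι → ℝ) × ℝ => x.1 i * x.2.1 j * x.2.2)
      (ψ := fun x : ι → ℝ => x i * x j) (by fun_prop) (by fun_prop)
  have e1 : ∀ ω, (∑ i, s i ω * ξ i ω) * (∑ i, t i ω * ξ i ω) * r ω =
      ∑ i, ∑ j, (s i ω * t j ω * r ω) * (ξ i ω * ξ j ω) := by
    intro ω
    rw [Finset.sum_mul_sum, Finset.sum_mul]
    refine Finset.sum_congr rfl fun i _ => ?_
    rw [Finset.sum_mul]
    exact Finset.sum_congr rfl fun j _ => by ring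
  have hi : ∀ i j, Integrable (fun ω => (s i ω * t j ω * r ω) * (ξ i ω * ξ j ω)) P :=
    fun i j => (hind' i j).integrable_mul (hst i j) (hxx i j)
  have e2 : ∀ i j, ∫ ω, (s i ω * t j ω * r ω) * (ξ i ω * ξ j ω) ∂P =
      if i = j then ∫ ω, s i ω * t j ω * r ω ∂P else 0 := by
    intro i j
    have := integral_comp_mul_of_indepFun (hind' i j) (by fun_prop) (by fun_prop)
      (f := fun x => x) (g := fun x => x) (by fun_prop) (by fun_prop)
    rw [this, h.integral_mul_eq h1]
    split_ifs <;> simp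
  simp_rw [e1, Finset.sum_mul]
  rw [integral_finsetSum _ fun i _ => integrable_finsetSum _ fun j _ => hi i j,
    integral_finsetSum _ fun i _ => hst i i]
  refine Finset.sum_congr rfl fun i _ => ?_
  rw [integral_finsetSum _ fun j _ => hi i j]
  simp_rw [e2]
  simp

/-- Second moment of the squared norm of a random vector. -/
theorem integral_sqNorm_sq_le [Fintype ι] (h : IndepCentered ξ P M) :
    Integrable (fun ω => (∑ i, ξ i ω ^ 2) ^ 2) P ∧
    ∫ ω, (∑ i, ξ i ω ^ 2) ^ 2 ∂P ≤ (Fintype.card ι : ℝ) ^ 2 * M ^ 2 := by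
  have hb : ∀ ω, (∑ i, ξ i ω ^ 2) ^ 2 ≤ Fintype.card ι * ∑ i, ξ i ω ^ 4 := by
    intro ω
    have := sq_sum_le_card_mul_sum_sq (s := Finset.univ) (f := fun i => ξ i ω ^ 2)
    simpa only [← pow_mul, Finset.card_univ] using this
  have hi : Integrable (fun ω => (Fintype.card ι : ℝ) * ∑ i, ξ i ω ^ 4) P :=
    (integrable_finsetSum _ fun i _ => (h.memLp i).integrable_pow_four).const_mul _
  have hm := h.meas
  have hi2 : Integrable (fun ω => (∑ i, ξ i ω ^ 2) ^ 2) P := by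
    refine hi.mono' (by fun_prop) (ae_of_all _ fun ω => ?_)
    rw [Real.norm_of_nonneg (sq_nonneg _)]
    exact hb ω
  refine ⟨hi2, (integral_mono hi2 hi hb).trans ?_⟩
  rw [integral_const_mul, integral_finsetSum _ fun i _ => (h.memLp i).integrable_pow_four, sq,
    mul_assoc]
  refine mul_le_mul_of_nonneg_left ?_ (by positivity)
  calc ∑ i, ∫ ω, ξ i ω ^ 4 ∂P ≤ ∑ i : ι, M ^ 2 := Finset.sum_le_sum fun i _ => h.pow_le i
    _ = _ := by simp

end IndepCentered

/-- The bilinear form `zᵢᵀ S zⱼ` in the rows of `Z`. -/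
def rowForm {n p : ℕ} (S : Matrix (Fin p) (Fin p) ℝ) (Z : Fin n → Fin p → ℝ) (i j : Fin n) : ℝ :=
  ∑ a, (∑ b, S a b * Z i b) * Z j a

/-- The form `rowForm` with its diagonal removed. -/
def offForm {n p : ℕ} (S : Matrix (Fin p) (Fin p) ℝ) (Z : Fin n → Fin p → ℝ) (i j : Fin n) : ℝ :=
  if i = j then 0 else rowForm S Z i j

/-- The operator norm of `S` is at most `C`. -/
def OpBound {p : ℕ} (S : Matrix (Fin p) (Fin p) ℝ) (C : ℝ) : Prop :=
  ∀ v : Fin p → ℝ, ∑ a, (∑ b, S a b * v b) ^ 2 ≤ C ^ 2 * ∑ a, v a ^ 2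

/-- Squared Frobenius norm. -/
def frobSq {ι κ : Type*} [Fintype ι] [Fintype κ] (S : Matrix ι κ ℝ) : ℝ := ∑ a, ∑ b, S a b ^ 2

variable {n p : ℕ} {S : Matrix (Fin p) (Fin p) ℝ} {C M : ℝ} {Z : Ω → Fin n → Fin p → ℝ}

theorem rowForm_comm (hS : S.IsSymm) (z : Fin n → Fin p → ℝ) (i j : Fin n) :
    rowForm S z i j = rowForm S z j i := by
  simp only [rowForm, Finset.sum_mul]
  rw [Finset.sum_comm]
  refine Finset.sum_congr rfl fun a _ => Finset.sum_congr rfl fun b _ => ?_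
  rw [← hS.apply]
  ring

/-- Every column is the image of a coordinate unit vector, so its squared length is at most `C ^ 2`.
-/
theorem OpBound.frobSq_le (h : OpBound S C) : frobSq S ≤ C ^ 2 * p := by
  rw [frobSq, Finset.sum_comm]
  have : ∀ b, ∑ a, S a b ^ 2 ≤ C ^ 2 := fun b => by
    have := h (Pi.single b 1)
    simpa [Pi.single_apply, ite_pow] using this
  calc ∑ b, ∑ a, S a b ^ 2 ≤ ∑ _b : Fin p, C ^ 2 := Finset.sum_le_sum fun b _ => this b
    _ = _ := by simp [mul_comm]

theorem sum_mul_self_apply (S : Matrix (Fin p) (Fin p) ℝ) (v : Fin p → ℝ) (a : Fin p) :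
    ∑ b, (S * S) a b * v b = ∑ c, S a c * ∑ b, S c b * v b := by
  simp only [Matrix.mul_apply, Finset.sum_mul, Finset.mul_sum]
  rw [Finset.sum_comm]
  exact Finset.sum_congr rfl fun c _ => Finset.sum_congr rfl fun b _ => by ring

/-- Averaging two forms over a row they share leaves the inner product of `S zᵢ` and `S zₖ`;
rewriting it as a form for `S * S` allows the contraction to be repeated. -/
theorem rowForm_mul_self (hS : S.IsSymm) (z : Fin n → Fin p → ℝ) (i k : Fin n) :
    rowForm (S * S) z i k = ∑ a, (∑ b, S a b * z i b) * (∑ b, S a b * z k b) := by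
  simp only [rowForm, sum_mul_self_apply]
  simp only [Finset.sum_mul _ _ (z k _)]
  rw [Finset.sum_comm]
  refine Finset.sum_congr rfl fun c _ => ?_
  rw [Finset.mul_sum]
  refine Finset.sum_congr rfl fun a _ => ?_
  rw [← hS.apply a c]
  ring

theorem OpBound.sq (h : OpBound S C) : OpBound (S * S) (C ^ 2) := by
  intro v
  have h1 := h fun a => ∑ b, S a b * v b
  simp_rw [sum_mul_self_apply]
  have := mul_le_mul_of_nonneg_left (h v) (sq_nonneg C)
  nlinarith

/-- The rows of a matrix with independent standardized entries. -/
structure StdEntries (Z : Ω → Fin n → Fin p → ℝ) (P : Measure Ω) (M : ℝ) : Prop where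
  entries : IndepCentered (fun (ij : Fin n × Fin p) ω => Z ω ij.1 ij.2) P M
  var_one : ∀ i j, ∫ ω, Z ω i j ^ 2 ∂P = 1

namespace StdEntries

theorem row (h : StdEntries Z P M) (i : Fin n) : IndepCentered (fun j ω => Z ω i j) P M where
  meas j := h.entries.meas (i, j)
  indep := h.entries.indep.precomp (g := fun j => (i, j)) fun a b hab => by simpa using hab
  memLp j := h.entries.memLp (i, j)
  mean j := h.entries.mean (i, j)
  sq_le j := h.entries.sq_le (i, j)
  pow_le j := h.entries.pow_le (i, j)

theorem measurable_entry (h : StdEntries Z P M) (i : Fin n) (j : Fin p) :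
    Measurable fun ω => Z ω i j := h.entries.meas (i, j)

theorem measurable_row (h : StdEntries Z P M) (i : Fin n) : Measurable fun ω => Z ω i :=
  measurable_pi_iff.2 fun j => h.measurable_entry i j

theorem indep_rows (h : StdEntries Z P M) : iIndepFun (fun i ω => Z ω i) P :=
  iIndepFun.rows h.measurable_entry h.entries.indep

theorem measurable_rowForm (h : StdEntries Z P M) (i j : Fin n) :
    Measurable fun ω => rowForm S (Z ω) i j := by
  have := h.measurable_entry
  unfold rowForm
  fun_prop

/-- Given row `i`, this is a linear form in row `j` with coefficient vector `S zᵢ`, of squared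
length at most `C² |zᵢ|²`. The linear-form bound gives `3 M² C⁴ |zᵢ|⁴`, and `E |zᵢ|⁴ ≤ p² M²`. -/
theorem rowForm_pow_four (h : StdEntries Z P M) (hC : OpBound S C) {i j : Fin n} (hij : i ≠ j) :
    MemLp (fun ω => rowForm S (Z ω) i j) 4 P ∧
    ∫ ω, rowForm S (Z ω) i j ^ 4 ∂P ≤ 3 * M ^ 4 * C ^ 4 * p ^ 2 := by
  obtain ⟨hi, hle⟩ := (h.row i).integral_sqNorm_sq_le
  have key := (h.indep_rows.indepFun hij.symm).integrable_and_integral_le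
    (h.measurable_row j) (h.measurable_row i)
    (f := fun x => (∑ a, (∑ b, S a b * x.2 b) * x.1 a) ^ 4) (by fun_prop)
    (fun x => by positivity)
    (G := fun ω => 3 * M ^ 2 * C ^ 4 * (∑ b, Z ω i b ^ 2) ^ 2) (hi.const_mul _) (fun ω' => by
      set v : Fin p → ℝ := fun a => ∑ b, S a b * Z ω' i b
      refine ⟨((h.row j).memLp_sum Finset.univ v).integrable_pow_four,
        ((h.row j).integral_sum_pow_four_le Finset.univ v).trans ?_⟩
      have h1 := hC (Z ω' i)
      have h2 : (∑ a, v a ^ 2) ^ 2 ≤ (C ^ 2 * ∑ a, Z ω' i a ^ 2) ^ 2 :=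
        pow_le_pow_left₀ (Finset.sum_nonneg fun _ _ => sq_nonneg _) h1 2
      calc 3 * M ^ 2 * (∑ a, v a ^ 2) ^ 2 ≤ 3 * M ^ 2 * (C ^ 2 * ∑ a, Z ω' i a ^ 2) ^ 2 :=
            mul_le_mul_of_nonneg_left h2 (by positivity)
        _ = _ := by ring)
  refine ⟨(memLp_four_iff_integrable_pow (h.measurable_rowForm i j).aestronglyMeasurable).2 key.1,
    key.2.trans ?_⟩
  rw [integral_const_mul]
  rw [Fintype.card_fin] at hle
  calc _ ≤ 3 * M ^ 2 * C ^ 4 * ((p : ℝ) ^ 2 * M ^ 2) :=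
        mul_le_mul_of_nonneg_left hle (by positivity)
    _ = _ := by ring

theorem integral_rowForm_sq (h : StdEntries Z P M) {i j : Fin n} (hij : i ≠ j) :
    ∫ ω, rowForm S (Z ω) i j ^ 2 ∂P = frobSq S := by
  have hm := h.measurable_entry
  have key := (h.row j).integral_linForm_mul_linForm (h.var_one j)
    (s := fun a ω => ∑ b, S a b * Z ω i b) (t := fun a ω => ∑ b, S a b * Z ω i b)
    (r := fun _ => 1) (fun a => (h.row i).memLp_sum _ _) (fun a => (h.row i).memLp_sum _ _)
    (memLp_const 1) (by fun_prop) (by fun_prop) (by fun_prop)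
    ((h.indep_rows.indepFun hij).comp
      (φ := fun x : Fin p → ℝ => ((fun a => ∑ b, S a b * x b), (fun a => ∑ b, S a b * x b),
        (1 : ℝ))) (ψ := fun x => x) (by fun_prop) (by fun_prop))
  simp only [mul_one, ← sq] at key
  simp only [rowForm, frobSq]
  rw [key, integral_finsetSum _ fun a _ =>
    (memLp_two_of_four ((h.row i).memLp_sum Finset.univ (S a))).integrable_sq]
  refine Finset.sum_congr rfl fun a _ => ?_
  rw [(h.row i).integral_sum_sq]
  simp [h.var_one]

theorem integral_rowForm_diag (h : StdEntries Z P M) (hS : S.IsSymm) (i : Fin n) :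
    MemLp (fun ω => rowForm S (Z ω) i i - S.trace) 2 P ∧
    ∫ ω, (rowForm S (Z ω) i i - S.trace) ^ 2 ∂P ≤ 8 * M ^ 2 * frobSq S := by
  have := (h.row i).integral_quadForm_sq_le S (fun a b => hS.apply b a) Finset.univ
  have e : ∀ ω, ∑ a, ∑ b, S a b * Z ω i a * Z ω i b - ∑ a, S a a * ∫ ω, Z ω i a ^ 2 ∂P =
      rowForm S (Z ω) i i - S.trace := by
    intro ω
    simp only [h.var_one, mul_one, rowForm, Matrix.trace, Matrix.diag, Finset.sum_mul]
    congr 1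
    exact Finset.sum_congr rfl fun a _ => Finset.sum_congr rfl fun b _ => by ring
  simp_rw [e] at this
  exact this

theorem indepFun_rows_comp (h : StdEntries Z P M) {s : Finset (Fin n)} {j : Fin n} (hj : j ∉ s)
    {γ : Type*} [MeasurableSpace γ] {F : (s → Fin p → ℝ) → γ} (hF : Measurable F) :
    IndepFun (fun ω => F (fun a => Z ω a)) (fun ω => Z ω j) P := by
  have hψ : Measurable fun x : ↥({j} : Finset (Fin n)) → Fin p → ℝ => x ⟨j, by simp⟩ :=
    measurable_pi_apply _
  exact (h.indep_rows.indepFun_finset s {j} (by simpa using hj) h.measurable_row).comp hF hψ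

/-- Two averages contract the cycle. Row `j` merges its two forms into one for `S * S` between `i`
and `k`, row `l` does the same with the other two, and the mean square of that form is `frobSq (S *
S)`. The order `p`, against `p²` from fourth moments alone, pays for the `n⁴` choices of distinct
indices. -/
theorem integral_rowForm_cycle (h : StdEntries Z P M) (hS : S.IsSymm) (hC : OpBound S C)
    {i j k l : Fin n} (hij : i ≠ j) (hik : i ≠ k) (hil : i ≠ l) (hjk : j ≠ k) (hjl : j ≠ l)
    (hkl : k ≠ l) :
    ∫ ω, rowForm S (Z ω) i j * rowForm S (Z ω) j k * rowForm S (Z ω) k l * rowForm S (Z ω) l i ∂P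
      ≤ C ^ 4 * p := by
  have hm := h.measurable_entry
  have hmg := h.measurable_rowForm (S := S)
  have hind := h.indep_rows
  have hs4 : ∀ i a, MemLp (fun ω => ∑ b, S a b * Z ω i b) 4 P :=
    fun i a => (h.row i).memLp_sum Finset.univ (S a)
  have hg4 : ∀ {i j}, i ≠ j → MemLp (fun ω => rowForm S (Z ω) i j) 4 P :=
    fun hij => (h.rowForm_pow_four hC hij).1
  have hSS4 := (h.rowForm_pow_four hC.sq hik).1
  have h1 := (h.row j).integral_linForm_mul_linForm (h.var_one j)
    (s := fun a ω => ∑ b, S a b * Z ω i b) (t := fun a ω => ∑ b, S a b * Z ω k b)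
    (r := fun ω => rowForm S (Z ω) k l * rowForm S (Z ω) i l) (hs4 i) (hs4 k)
    (memLp_two_mul_of_four (hg4 hkl) (hg4 hil)) (by fun_prop) (by fun_prop) (by fun_prop)
    (h.indepFun_rows_comp (s := {i, k, l}) (j := j) (by simp [hij.symm, hjk, hjl])
      (F := fun x => ((fun a => ∑ b, S a b * x ⟨i, by simp⟩ b),
        (fun a => ∑ b, S a b * x ⟨k, by simp⟩ b),
        (∑ a, (∑ b, S a b * x ⟨k, by simp⟩ b) * x ⟨l, by simp⟩ a) *
          (∑ a, (∑ b, S a b * x ⟨i, by simp⟩ b) * x ⟨l, by simp⟩ a))) (by fun_prop))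
  have h2 := (h.row l).integral_linForm_mul_linForm (h.var_one l)
    (s := fun a ω => ∑ b, S a b * Z ω k b) (t := fun a ω => ∑ b, S a b * Z ω i b)
    (r := fun ω => rowForm (S * S) (Z ω) i k) (hs4 k) (hs4 i)
    (memLp_two_of_four hSS4) (by fun_prop) (by fun_prop) (h.measurable_rowForm _ _)
    (h.indepFun_rows_comp (s := {i, k}) (j := l) (by simp [hil.symm, hkl.symm])
      (F := fun x => ((fun a => ∑ b, S a b * x ⟨k, by simp⟩ b),
        (fun a => ∑ b, S a b * x ⟨i, by simp⟩ b),
        ∑ a, (∑ b, (S * S) a b * x ⟨i, by simp⟩ b) * x ⟨k, by simp⟩ a)) (by fun_prop))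
  have h3 := h.integral_rowForm_sq (S := S * S) hik
  calc ∫ ω, rowForm S (Z ω) i j * rowForm S (Z ω) j k * rowForm S (Z ω) k l
        * rowForm S (Z ω) l i ∂P
      = ∫ ω, (∑ a, (∑ b, S a b * Z ω i b) * Z ω j a) * (∑ a, (∑ b, S a b * Z ω k b) * Z ω j a)
          * (rowForm S (Z ω) k l * rowForm S (Z ω) i l) ∂P := by
        congr 1
        ext ω
        rw [rowForm_comm hS _ j k, rowForm_comm hS _ l i, mul_assoc (_ * _)]
        rfl
    _ = ∫ ω, (∑ a, (∑ b, S a b * Z ω k b) * Z ω l a) * (∑ a, (∑ b, S a b * Z ω i b) * Z ω l a)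
          * rowForm (S * S) (Z ω) i k ∂P := by
        rw [h1]
        congr 1
        ext ω
        rw [rowForm_mul_self hS, mul_comm]
        rfl
    _ = frobSq (S * S) := by
        rw [h2, ← h3]
        congr 1
        ext ω
        rw [rowForm_mul_self hS, sq]
        congr 1
        exact Finset.sum_congr rfl fun a _ => mul_comm _ _
    _ ≤ (C ^ 2) ^ 2 * p := hC.sq.frobSq_le
    _ = C ^ 4 * p := by ring

end StdEntries

end RowForms

/-! ### Off-diagonal part of the Gram matrix: fourth spectral moment and Frobenius norm -/

section OffForms

variable {Ω : Type*} [MeasurableSpace Ω] {P : Measure Ω} [IsProbabilityMeasure P]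
  {n p : ℕ} {S : Matrix (Fin p) (Fin p) ℝ} {C M : ℝ} {Z : Ω → Fin n → Fin p → ℝ}

theorem sq_sum_sum {ι κ : Type*} [Fintype ι] [Fintype κ] (f : ι → κ → ℝ) :
    (∑ i, ∑ j, f i j) ^ 2 = ∑ i, ∑ j, ∑ k, ∑ l, f i j * f k l := by
  rw [sq, Finset.sum_mul]
  refine Finset.sum_congr rfl fun i _ => ?_
  rw [Finset.sum_mul]
  refine Finset.sum_congr rfl fun j _ => ?_
  rw [Finset.mul_sum]
  exact Finset.sum_congr rfl fun k _ => Finset.mul_sum _ _ _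

theorem offForm_comm (hS : S.IsSymm) (z : Fin n → Fin p → ℝ) (i j : Fin n) :
    offForm S z i j = offForm S z j i := by
  simp only [offForm, rowForm_comm hS z i j, eq_comm]

namespace StdEntries

theorem offForm_pow_four (h : StdEntries Z P M) (hC : OpBound S C) (i j : Fin n) :
    MemLp (fun ω => offForm S (Z ω) i j) 4 P ∧
    ∫ ω, offForm S (Z ω) i j ^ 4 ∂P ≤ 3 * M ^ 4 * C ^ 4 * p ^ 2 := by
  by_cases hij : i = j
  · simp only [offForm, hij, if_true]
    refine ⟨memLp_const 0, ?_⟩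
    simp
    positivity
  · simpa only [offForm, hij, if_false] using h.rowForm_pow_four hC hij

/-- By AM-GM only individual fourth moments matter, so the bound is insensitive to coincidences
among the indices. -/
theorem integral_offForm_mul_four_le (h : StdEntries Z P M) (hC : OpBound S C)
    (i j k l i' j' k' l' : Fin n) :
    ∫ ω, offForm S (Z ω) i j * offForm S (Z ω) k l * offForm S (Z ω) i' j'
      * offForm S (Z ω) k' l' ∂P ≤ 3 * M ^ 4 * C ^ 4 * p ^ 2 := by
  obtain ⟨a, a'⟩ := h.offForm_pow_four hC i j
  obtain ⟨b, b'⟩ := h.offForm_pow_four hC k l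
  obtain ⟨c, c'⟩ := h.offForm_pow_four hC i' j'
  obtain ⟨d, d'⟩ := h.offForm_pow_four hC k' l'
  have hab := a.integrable_pow_four.fun_add b.integrable_pow_four
  have habc := hab.fun_add c.integrable_pow_four
  have habcd := habc.fun_add d.integrable_pow_four
  refine (integral_mono (integrable_mul_four a b c d) (habcd.div_const 4)
    fun ω => (le_abs_self _).trans (mul_four_abs_le _ _ _ _)).trans ?_
  rw [integral_div, integral_add habc d.integrable_pow_four, integral_add hab
    c.integrable_pow_four, integral_add a.integrable_pow_four b.integrable_pow_four]
  linarith

/-- The expected fourth power of the Schatten 4-norm of the off-diagonal part of `Z S Zᵀ`. -/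
theorem integral_offForm_schatten_le (h : StdEntries Z P M) (hS : S.IsSymm) (hC : OpBound S C) :
    Integrable (fun ω => ∑ i, ∑ k, (∑ j, offForm S (Z ω) i j * offForm S (Z ω) j k) ^ 2) P ∧
    ∫ ω, ∑ i, ∑ k, (∑ j, offForm S (Z ω) i j * offForm S (Z ω) j k) ^ 2 ∂P ≤
      2 * n ^ 3 * (3 * M ^ 4 * C ^ 4 * p ^ 2) + n ^ 4 * (C ^ 4 * p) := by
  set A : ℝ := 3 * M ^ 4 * C ^ 4 * p ^ 2 with hA
  have hA0 : 0 ≤ A := by positivity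
  set B : ℝ := C ^ 4 * p with hB
  have hB0 : 0 ≤ B := by positivity
  set o : Ω → Fin n → Fin n → ℝ := fun ω => offForm S (Z ω) with ho
  have hi : ∀ i k j l, Integrable (fun ω => o ω i j * o ω j k * o ω k l * o ω l i) P :=
    fun i k j l => integrable_mul_four (h.offForm_pow_four hC _ _).1 (h.offForm_pow_four hC _ _).1
      (h.offForm_pow_four hC _ _).1 (h.offForm_pow_four hC _ _).1
  -- A coincidence `i = k` or `j = l` costs the crude bound `A`, but leaves only `n ^ 3` cycles of
  -- each kind. Any other coincidence is between neighbours on the cycle, and the removed diagonal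
  -- makes the product vanish.
  have ht : ∀ i k j l, ∫ ω, o ω i j * o ω j k * o ω k l * o ω l i ∂P ≤
      (if i = k then A else 0) + (if j = l then A else 0) + B := by
    intro i k j l
    have hle := h.integral_offForm_mul_four_le hC i j j k k l l i
    by_cases hik : i = k
    · rw [if_pos hik]
      have : 0 ≤ if j = l then A else 0 := by split_ifs <;> simp [hA0]
      linarith
    by_cases hjl : j = l
    · rw [if_pos hjl]
      have : 0 ≤ if i = k then A else 0 := by split_ifs <;> simp [hA0]
      linarith
    rw [if_neg hik, if_neg hjl, zero_add, zero_add]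
    by_cases hij : i = j
    · simpa [ho, offForm, hij] using hB0
    by_cases hjk : j = k
    · simpa [ho, offForm, hjk] using hB0
    by_cases hkl : k = l
    · simpa [ho, offForm, hkl] using hB0
    by_cases hli : l = i
    · simpa [ho, offForm, hli] using hB0
    simpa only [ho, offForm, if_neg hij, if_neg hjk, if_neg hkl, if_neg hli] using
      h.integral_rowForm_cycle hS hC hij hik (Ne.symm hli) hjk hjl hkl
  have e : ∀ ω, ∑ i, ∑ k, (∑ j, o ω i j * o ω j k) ^ 2 =
      ∑ i, ∑ k, ∑ j, ∑ l, o ω i j * o ω j k * o ω k l * o ω l i := by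
    intro ω
    refine Finset.sum_congr rfl fun i _ => Finset.sum_congr rfl fun k _ => ?_
    rw [sq, Finset.sum_mul_sum]
    refine Finset.sum_congr rfl fun j _ => Finset.sum_congr rfl fun l _ => ?_
    simp only [ho]
    rw [offForm_comm hS _ k l, offForm_comm hS _ l i]
    ring
  have hi' : Integrable (fun ω => ∑ i, ∑ k, ∑ j, ∑ l, o ω i j * o ω j k * o ω k l * o ω l i) P :=
    integrable_finsetSum _ fun i _ => integrable_finsetSum _ fun k _ =>
      integrable_finsetSum _ fun j _ => integrable_finsetSum _ fun l _ => hi i k j l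
  change Integrable (fun ω => ∑ i, ∑ k, (∑ j, o ω i j * o ω j k) ^ 2) P ∧
    ∫ ω, ∑ i, ∑ k, (∑ j, o ω i j * o ω j k) ^ 2 ∂P ≤ _
  simp_rw [e]
  refine ⟨hi', ?_⟩
  calc ∫ ω, ∑ i, ∑ k, ∑ j, ∑ l, o ω i j * o ω j k * o ω k l * o ω l i ∂P
      = ∑ i, ∑ k, ∑ j, ∑ l, ∫ ω, o ω i j * o ω j k * o ω k l * o ω l i ∂P := by
        rw [integral_finsetSum _ fun i _ => integrable_finsetSum _ fun k _ =>
          integrable_finsetSum _ fun j _ => integrable_finsetSum _ fun l _ => hi i k j l]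
        refine Finset.sum_congr rfl fun i _ => ?_
        rw [integral_finsetSum _ fun k _ => integrable_finsetSum _ fun j _ =>
          integrable_finsetSum _ fun l _ => hi i k j l]
        refine Finset.sum_congr rfl fun k _ => ?_
        rw [integral_finsetSum _ fun j _ => integrable_finsetSum _ fun l _ => hi i k j l]
        refine Finset.sum_congr rfl fun j _ => ?_
        rw [integral_finsetSum _ fun l _ => hi i k j l]
    _ ≤ ∑ i : Fin n, ∑ k : Fin n, ∑ j : Fin n, ∑ l : Fin n,
        ((if i = k then A else 0) + (if j = l then A else 0) + B) :=
        Finset.sum_le_sum fun i _ => Finset.sum_le_sum fun k _ => Finset.sum_le_sum fun j _ =>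
          Finset.sum_le_sum fun l _ => ht i k j l
    _ = 2 * n ^ 3 * A + n ^ 4 * B := by
        simp only [Finset.sum_add_distrib, Finset.sum_const, Finset.card_univ, Fintype.card_fin,
          Finset.sum_ite_eq, Finset.mem_univ, if_true, nsmul_eq_mul, ← Finset.mul_sum]
        ring

theorem integral_sum_rowForm_diag_le (h : StdEntries Z P M) (hS : S.IsSymm) (hC : OpBound S C) :
    Integrable (fun ω => ∑ i, (rowForm S (Z ω) i i - S.trace) ^ 2) P ∧
    ∫ ω, ∑ i, (rowForm S (Z ω) i i - S.trace) ^ 2 ∂P ≤ n * (8 * M ^ 2 * (C ^ 2 * p)) := by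
  have hi := fun i => (h.integral_rowForm_diag hS i).1.integrable_sq
  refine ⟨integrable_finsetSum _ fun i _ => hi i, ?_⟩
  rw [integral_finsetSum _ fun i _ => hi i]
  calc ∑ i, ∫ ω, (rowForm S (Z ω) i i - S.trace) ^ 2 ∂P
      ≤ ∑ _i : Fin n, 8 * M ^ 2 * (C ^ 2 * p) := Finset.sum_le_sum fun i _ =>
        (h.integral_rowForm_diag hS i).2.trans
          (mul_le_mul_of_nonneg_left hC.frobSq_le (by positivity))
    _ = _ := by simp

theorem integral_sum_offForm_sq (h : StdEntries Z P M) (hC : OpBound S C) :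
    ∫ ω, ∑ i, ∑ j, offForm S (Z ω) i j ^ 2 ∂P = n * (n - 1) * frobSq S := by
  have hi : ∀ i j, Integrable (fun ω => offForm S (Z ω) i j ^ 2) P := fun i j =>
    (memLp_two_of_four (h.offForm_pow_four hC i j).1).integrable_sq
  have hv : ∀ i j : Fin n, ∫ ω, offForm S (Z ω) i j ^ 2 ∂P =
      frobSq S - if i = j then frobSq S else 0 := by
    intro i j
    by_cases hij : i = j
    · simp [offForm, hij]
    · simp only [offForm, hij, if_false, h.integral_rowForm_sq hij, sub_zero]
  rw [integral_finsetSum _ fun i _ => integrable_finsetSum _ fun j _ => hi i j]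
  simp_rw [integral_finsetSum _ fun j _ => hi _ j, hv]
  simp only [Finset.sum_sub_distrib, Finset.sum_const, Finset.card_univ, Fintype.card_fin,
    Finset.sum_ite_eq, Finset.mem_univ, if_true, nsmul_eq_mul]
  ring

/-- Concentration of the squared Frobenius norm of the off-diagonal part of `Z S Zᵀ`. -/
theorem integral_sum_offForm_sq_sub_le (h : StdEntries Z P M) (hC : OpBound S C) :
    Integrable (fun ω => (∑ i, ∑ j, offForm S (Z ω) i j ^ 2 - n * (n - 1) * frobSq S) ^ 2) P ∧
    ∫ ω, (∑ i, ∑ j, offForm S (Z ω) i j ^ 2 - n * (n - 1) * frobSq S) ^ 2 ∂P ≤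
      4 * n ^ 3 * (3 * M ^ 4 * C ^ 4 * p ^ 2) := by
  set A : ℝ := 3 * M ^ 4 * C ^ 4 * p ^ 2 with hA
  have hA0 : 0 ≤ A := by positivity
  set o : Ω → Fin n → Fin n → ℝ := fun ω => offForm S (Z ω) with ho
  have ho2 : ∀ i j, MemLp (fun ω => o ω i j ^ 2) 2 P := fun i j => by
    simpa only [sq] using memLp_two_mul_of_four (h.offForm_pow_four hC i j).1
      (h.offForm_pow_four hC i j).1
  have hi : ∀ i j, Integrable (fun ω => o ω i j ^ 2) P := fun i j =>
    (ho2 i j).integrable (by norm_num)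
  set T : Ω → ℝ := fun ω => ∑ i, ∑ j, o ω i j ^ 2 with hT
  have hT2 : MemLp T 2 P := memLp_finsetSum _ fun i _ => memLp_finsetSum _ fun j _ => ho2 i j
  have hET : ∫ ω, T ω ∂P = n * (n - 1) * frobSq S := h.integral_sum_offForm_sq hC
  set m : ℝ := n * (n - 1) * frobSq S
  have hsum : m = ∑ i, ∑ j, ∫ ω, o ω i j ^ 2 ∂P := by
    rw [← hET, integral_finsetSum _ fun i _ => integrable_finsetSum _ fun j _ => hi i j]
    exact Finset.sum_congr rfl fun i _ => integral_finsetSum _ fun j _ => hi i j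
  have hnn : ∀ i j, 0 ≤ ∫ ω, o ω i j ^ 2 ∂P := fun i j => integral_nonneg fun ω => sq_nonneg _
  have hpi : ∀ i j k l, Integrable (fun ω => o ω i j ^ 2 * o ω k l ^ 2) P := fun i j k l =>
    (ho2 i j).integrable_mul (ho2 k l)
  have hit : ∀ {a b : Fin n}, 0 ≤ if a = b then A else 0 := by
    intro a b; split_ifs
    exacts [hA0, le_rfl]
  -- Entries whose index pairs are disjoint depend on different rows, so they are uncorrelated. Each
  -- of the four possible coincidences costs `A` on `n ^ 3` quadruples.
  have ht : ∀ i j k l, ∫ ω, o ω i j ^ 2 * o ω k l ^ 2 ∂P ≤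
      (∫ ω, o ω i j ^ 2 ∂P) * (∫ ω, o ω k l ^ 2 ∂P) + ((if i = k then A else 0)
        + (if i = l then A else 0) + (if j = k then A else 0) + (if j = l then A else 0)) := by
    intro i j k l
    have hp := mul_nonneg (hnn i j) (hnn k l)
    have hle : ∫ ω, o ω i j ^ 2 * o ω k l ^ 2 ∂P ≤ A := by
      have := h.integral_offForm_mul_four_le hC i j i j k l k l
      refine le_trans (le_of_eq ?_) this
      congr 1
      ext ω
      simp only [ho]
      ring
    have h1 := hit (a := i) (b := k)
    have h2 := hit (a := i) (b := l)
    have h3 := hit (a := j) (b := k)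
    have h4 := hit (a := j) (b := l)
    by_cases hik : i = k
    · rw [if_pos hik]; linarith
    by_cases hil : i = l
    · rw [if_pos hil]; linarith
    by_cases hjk : j = k
    · rw [if_pos hjk]; linarith
    by_cases hjl : j = l
    · rw [if_pos hjl]; linarith
    have hm := h.measurable_row
    have hind := h.indep_rows.indepFun_prodMk_prodMk hm i j k l hik hil hjk hjl
    -- The case distinction remains because `i = j` and `k = l` have not been excluded.
    have hF : ∀ a b : Fin n, Measurable fun x : (Fin p → ℝ) × (Fin p → ℝ) =>
        if a = b then (0 : ℝ) else (∑ c, (∑ d, S c d * x.1 d) * x.2 c) := by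
      intro a b
      split_ifs <;> fun_prop
    have := integral_comp_mul_of_indepFun hind (by fun_prop) (by fun_prop)
      ((hF i j).pow_const 2) ((hF k l).pow_const 2)
    change ∫ ω, o ω i j ^ 2 * o ω k l ^ 2 ∂P =
      (∫ ω, o ω i j ^ 2 ∂P) * (∫ ω, o ω k l ^ 2 ∂P) at this
    rw [this]
    linarith
  have hTT : ∫ ω, T ω ^ 2 ∂P ≤ m ^ 2 + 4 * n ^ 3 * A := by
    have e : ∀ ω, T ω ^ 2 = ∑ i, ∑ j, ∑ k, ∑ l, o ω i j ^ 2 * o ω k l ^ 2 := fun ω =>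
      sq_sum_sum _
    simp_rw [e]
    calc ∫ ω, ∑ i, ∑ j, ∑ k, ∑ l, o ω i j ^ 2 * o ω k l ^ 2 ∂P
        = ∑ i, ∑ j, ∑ k, ∑ l, ∫ ω, o ω i j ^ 2 * o ω k l ^ 2 ∂P := by
          rw [integral_finsetSum _ fun i _ => integrable_finsetSum _ fun k _ =>
            integrable_finsetSum _ fun j _ => integrable_finsetSum _ fun l _ => hpi i k j l]
          refine Finset.sum_congr rfl fun i _ => ?_
          rw [integral_finsetSum _ fun k _ => integrable_finsetSum _ fun j _ =>
            integrable_finsetSum _ fun l _ => hpi i k j l]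
          refine Finset.sum_congr rfl fun k _ => ?_
          rw [integral_finsetSum _ fun j _ => integrable_finsetSum _ fun l _ => hpi i k j l]
          refine Finset.sum_congr rfl fun j _ => ?_
          rw [integral_finsetSum _ fun l _ => hpi i k j l]
      _ ≤ ∑ i, ∑ j, ∑ k, ∑ l, ((∫ ω, o ω i j ^ 2 ∂P) * (∫ ω, o ω k l ^ 2 ∂P)
          + ((if i = k then A else 0) + (if i = l then A else 0) + (if j = k then A else 0)
            + (if j = l then A else 0))) :=
          Finset.sum_le_sum fun i _ => Finset.sum_le_sum fun k _ => Finset.sum_le_sum fun j _ =>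
            Finset.sum_le_sum fun l _ => ht i k j l
      _ = m ^ 2 + 4 * n ^ 3 * A := by
          have : m ^ 2 = ∑ i, ∑ j, ∑ k, ∑ l,
              (∫ ω, o ω i j ^ 2 ∂P) * (∫ ω, o ω k l ^ 2 ∂P) := by
            rw [hsum, sq_sum_sum]
          rw [this]
          simp only [Finset.sum_add_distrib, Finset.sum_const, Finset.card_univ, Fintype.card_fin,
            Finset.sum_ite_eq, Finset.mem_univ, if_true, nsmul_eq_mul, ← Finset.mul_sum]
          ring
  have e : (fun ω => (T ω - m) ^ 2) = fun ω => T ω ^ 2 + (-2 * m * T ω + m ^ 2) := by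
    ext ω; ring
  have i1 : Integrable (fun ω => -2 * m * T ω) P := (hT2.integrable (by norm_num)).const_mul _
  refine ⟨(hT2.sub (memLp_const m)).integrable_sq, ?_⟩
  change ∫ ω, (T ω - m) ^ 2 ∂P ≤ _
  rw [e, integral_add hT2.integrable_sq (i1.fun_add (integrable_const _)),
    integral_add i1 (integrable_const _), integral_const_mul, hET]
  simp only [integral_const, probReal_univ, smul_eq_mul, one_mul]
  linarith

end StdEntries

end OffForms

/-! ### Frobenius norm inequalities for symmetric matrices -/

section Frobenius

open Matrix

variable {ι κ : Type*} [Fintype ι] [Fintype κ]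

theorem frobSq_nonneg (A : Matrix ι κ ℝ) : 0 ≤ frobSq A :=
  Finset.sum_nonneg fun _ _ => Finset.sum_nonneg fun _ _ => sq_nonneg _

theorem frobSq_eq_trace (A : Matrix ι κ ℝ) : frobSq A = (Aᵀ * A).trace := by
  simp only [frobSq, trace, diag_apply, mul_apply, transpose_apply, ← sq]
  exact Finset.sum_comm

theorem frobSq_smul (c : ℝ) (A : Matrix ι κ ℝ) : frobSq (c • A) = c ^ 2 * frobSq A := by
  simp only [frobSq, Matrix.smul_apply, smul_eq_mul, mul_pow, Finset.mul_sum]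

theorem frobSq_add_le (A B : Matrix ι κ ℝ) : frobSq (A + B) ≤ 2 * frobSq A + 2 * frobSq B := by
  simp only [frobSq, Matrix.add_apply, Finset.mul_sum, ← Finset.sum_add_distrib]
  exact Finset.sum_le_sum fun i _ => Finset.sum_le_sum fun j _ => by
    nlinarith [sq_nonneg (A i j - B i j)]

theorem frobSq_one [DecidableEq ι] : frobSq (1 : Matrix ι ι ℝ) = Fintype.card ι := by
  simp [frobSq_eq_trace]

/-- Convexity of the fourth power of the Schatten 4-norm on symmetric matrices. -/
theorem frobSq_sq_add_le {D O : Matrix ι ι ℝ} (hD : D.IsSymm) (hO : O.IsSymm) :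
    frobSq ((D + O) * (D + O)) ≤ 8 * frobSq (D * D) + 8 * frobSq (O * O) := by
  have hs1 : (D + O).IsSymm := hD.add hO
  have hs2 : (D - O).IsSymm := hD.sub hO
  set U := D + O
  set V := D - O
  -- Parallelogram law. The Frobenius cross term `tr (U² V²)` equals `‖U V‖² ≥ 0`, so the
  -- contribution of `V²` can be dropped.
  have h1 : U * U + V * V = (2 : ℝ) • (D * D + O * O) := by
    simp only [U, V]
    rw [two_smul]
    noncomm_ring
  have h2 : frobSq (U * U + V * V) = frobSq (U * U) + frobSq (V * V) + 2 * frobSq (U * V) := by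
    have e : (U * U * (V * V)).trace = frobSq (U * V) := by
      rw [frobSq_eq_trace, transpose_mul, hs1, hs2,
        show V * U * (U * V) = V * (U * U * V) by simp only [Matrix.mul_assoc],
        trace_mul_comm V, Matrix.mul_assoc (U * U)]
    have e' : (V * V * (U * U)).trace = frobSq (U * V) := by rw [trace_mul_comm, e]
    rw [frobSq_eq_trace (U * U + V * V), frobSq_eq_trace (U * U), frobSq_eq_trace (V * V)]
    simp only [transpose_add, transpose_mul, hs1.eq, hs2.eq, Matrix.add_mul, Matrix.mul_add,
      trace_add, e, e']
    ring
  have h3 : frobSq (U * U) ≤ frobSq (U * U + V * V) := by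
    rw [h2]
    linarith [frobSq_nonneg (V * V), frobSq_nonneg (U * V)]
  rw [h1, frobSq_smul] at h3
  linarith [frobSq_add_le (D * D) (O * O)]

/-- Comparison of the second and fourth moments of the spectrum of a symmetric matrix. -/
theorem frobSq_le_frobSq_sq {G : Matrix ι ι ℝ} (hG : G.IsSymm) {t : ℝ} (ht : 0 < t) :
    frobSq G ≤ t * Fintype.card ι / 2 + frobSq (G * G) / (2 * t) := by
  have e : frobSq G = ∑ i, (G * G) i i := by rw [frobSq_eq_trace, hG.eq]; rfl
  -- AM-GM; the bound is efficient when `t` is the typical size of a diagonal entry of `G * G`.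
  have hle : ∀ i, (G * G) i i ≤ t / 2 + (G * G) i i ^ 2 / (2 * t) := by
    intro i
    have : t / 2 + (G * G) i i ^ 2 / (2 * t) - (G * G) i i = ((G * G) i i - t) ^ 2 / (2 * t) := by
      field_simp; ring
    have h0 : 0 ≤ ((G * G) i i - t) ^ 2 / (2 * t) := by positivity
    linarith
  have hd : ∑ i, (G * G) i i ^ 2 ≤ frobSq (G * G) :=
    Finset.sum_le_sum fun i _ => Finset.single_le_sum (f := fun j => (G * G) i j ^ 2)
      (fun j _ => sq_nonneg _) (Finset.mem_univ i)
  rw [e]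
  calc ∑ i, (G * G) i i ≤ ∑ i, (t / 2 + (G * G) i i ^ 2 / (2 * t)) :=
        Finset.sum_le_sum fun i _ => hle i
    _ = t * Fintype.card ι / 2 + (∑ i, (G * G) i i ^ 2) / (2 * t) := by
        rw [Finset.sum_add_distrib, Finset.sum_div]
        simp; ring
    _ ≤ _ := by gcongr

/-- The Frobenius norm of `Bᵀ H B`, when `H` commutes with `B Bᵀ`. -/
theorem frobSq_conj_eq {B : Matrix ι κ ℝ} {H : Matrix ι ι ℝ} (hH : H.IsSymm)
    (hc : Commute H (B * Bᵀ)) : frobSq (Bᵀ * H * B) = frobSq (B * Bᵀ * H) := by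
  rw [frobSq_eq_trace, frobSq_eq_trace]
  simp only [transpose_mul, transpose_transpose, hH.eq]
  calc (Bᵀ * (H * B) * (Bᵀ * H * B)).trace = ((H * B) * (Bᵀ * H * B) * Bᵀ).trace := by
        rw [Matrix.mul_assoc, trace_mul_comm]
    _ = (H * (B * Bᵀ) * (H * (B * Bᵀ))).trace := by simp only [Matrix.mul_assoc]
    _ = (H * (B * Bᵀ) * (B * Bᵀ * H)).trace := by rw [hc.eq]

end Frobenius

/-! ### The linear model as quadratic forms in the noise and random effects -/

section LinearModel

open Matrix

variable {n p : ℕ}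

/-- The matrix `[1, p^{-1/2} X]`, which maps the standardized randomness of the linear model to the
response. -/
noncomputable def modelMatrix (X : Matrix (Fin n) (Fin p) ℝ) :
    Matrix (Fin n) (Fin n ⊕ Fin p) ℝ :=
  fromCols 1 ((√(p : ℝ))⁻¹ • X)

/-- The noise and the rescaled random effects as one vector. -/
noncomputable def modelVector (β : Fin p → ℝ) (u : Fin n → ℝ) : Fin n ⊕ Fin p → ℝ :=
  Sum.elim u (√(p : ℝ) • β)

theorem modelMatrix_mulVec (hp : 0 < p) (X : Matrix (Fin n) (Fin p) ℝ) (β : Fin p → ℝ)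
    (u : Fin n → ℝ) : modelMatrix X *ᵥ modelVector β u = response X β u := by
  have : √(p : ℝ) ≠ 0 := by positivity
  rw [modelMatrix, modelVector, fromCols_mulVec]
  simp [response, smul_mulVec, mulVec_smul, smul_smul, this, add_comm]

theorem modelMatrix_mul_transpose (X : Matrix (Fin n) (Fin p) ℝ) :
    modelMatrix X * (modelMatrix X)ᵀ = 1 + (p : ℝ)⁻¹ • (X * Xᵀ) := by
  rw [modelMatrix, transpose_fromCols, fromCols_mul_fromRows]
  simp only [transpose_one, Matrix.mul_one, transpose_smul, Matrix.smul_mul, Matrix.mul_smul,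
    smul_smul]
  rw [← mul_inv, Real.mul_self_sqrt (by positivity)]

theorem sqNorm_mulVec_eq {κ : Type*} [Fintype κ] {m k : ℕ} (A : Matrix (Fin k) (Fin m) ℝ)
    (B : Matrix (Fin m) κ ℝ) (w : κ → ℝ) :
    sqNorm (A *ᵥ (B *ᵥ w)) = ∑ i, ∑ j, (Bᵀ * (Aᵀ * A) * B) i j * w i * w j := by
  have h1 : sqNorm (A *ᵥ (B *ᵥ w)) = (A *ᵥ (B *ᵥ w)) ⬝ᵥ (A *ᵥ (B *ᵥ w)) := by
    simp [sqNorm, dotProduct, sq]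
  have h2 : (A *ᵥ (B *ᵥ w)) ⬝ᵥ (A *ᵥ (B *ᵥ w)) = w ⬝ᵥ ((Bᵀ * (Aᵀ * A) * B) *ᵥ w) := by
    have : Bᵀ * (Aᵀ * A) * B = (A * B)ᵀ * (A * B) := by
      simp only [transpose_mul, Matrix.mul_assoc]
    rw [this, mulVec_mulVec, ← mulVec_mulVec w (A * B)ᵀ, dotProduct_mulVec w, vecMul_transpose]
  rw [h1, h2]
  simp only [dotProduct, mulVec, Finset.mul_sum]
  exact Finset.sum_congr rfl fun i _ => Finset.sum_congr rfl fun j _ => by ring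

/-- The left side is the mean of the quadratic form of `H` in the response when the noise has
variance `s` and the rescaled effects have variance `t`. -/
theorem trace_weighted_model (X : Matrix (Fin n) (Fin p) ℝ) (H : Matrix (Fin n) (Fin n) ℝ)
    (s t : ℝ) :
    ∑ i, ((modelMatrix X)ᵀ * H * modelMatrix X) i i * Sum.elim (fun _ => s) (fun _ => t) i =
      s * H.trace + t * ((p : ℝ)⁻¹ * (X * Xᵀ * H).trace) := by
  rw [modelMatrix, transpose_fromCols, fromRows_mul, fromRows_mul_fromCols, Fintype.sum_sum_type]
  simp only [fromBlocks_apply₁₁, fromBlocks_apply₂₂, Sum.elim_inl, Sum.elim_inr, ← Finset.sum_mul]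
  have e1 : ∑ i, ((1 : Matrix (Fin n) (Fin n) ℝ)ᵀ * H * (1 : Matrix (Fin n) (Fin n) ℝ)) i i = H.trace := by
    simp [trace]
  have e2 : ∑ i, (((√(p : ℝ))⁻¹ • X)ᵀ * H * ((√(p : ℝ))⁻¹ • X)) i i =
      (p : ℝ)⁻¹ * (X * Xᵀ * H).trace := by
    change trace _ = _
    rw [transpose_smul, Matrix.smul_mul, Matrix.smul_mul, Matrix.mul_smul, smul_smul, ← mul_inv,
      Real.mul_self_sqrt (by positivity), trace_smul, smul_eq_mul, trace_mul_comm,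
      ← Matrix.mul_assoc]
  rw [e1, e2]
  ring

theorem mHat1_eq (X : Matrix (Fin n) (Fin p) ℝ) :
    mHat1 X = (X * Xᵀ).trace / (n * p) := by
  rw [mHat1, sampleCov, trace_smul, smul_eq_mul, trace_mul_comm]
  ring

theorem mHat2_eq (X : Matrix (Fin n) (Fin p) ℝ) :
    mHat2 X = frobSq (X * Xᵀ) / (n ^ 2 * p) := by
  have e : (Xᵀ * X * (Xᵀ * X)).trace = frobSq (X * Xᵀ) := by
    rw [frobSq_eq_trace, transpose_mul, transpose_transpose, Matrix.mul_assoc, trace_mul_comm]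
    simp only [Matrix.mul_assoc]
  rw [mHat2, sampleCov, sq, Matrix.smul_mul, Matrix.mul_smul, smul_smul, trace_smul, smul_eq_mul, e]
  field_simp

/-- With `G = X Xᵀ`, `n² p m̃₂ = ‖G‖² - (tr G)²/n`, and Cauchy-Schwarz over the `n` diagonal entries
gives `(tr G)²/n ≤ ∑ Gᵢᵢ²`. The off-diagonal sum that is left serves both for almost sure positivity
and for the lower bound in probability. -/
theorem sum_sq_offDiag_le_mTilde2 (hn : 0 < n) (hp : 0 < p) (X : Matrix (Fin n) (Fin p) ℝ) :
    (∑ i, ∑ j, (if i = j then 0 else (X * Xᵀ) i j) ^ 2) / (n ^ 2 * p) ≤ mTilde2 X := by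
  set G := X * Xᵀ
  have e : mTilde2 X = (frobSq G - G.trace ^ 2 / n) / (n ^ 2 * p) := by
    rw [mTilde2, mHat1_eq, mHat2_eq]
    change frobSq G / _ - _ * (G.trace / _) ^ 2 = _
    field_simp
  rw [e]
  gcongr
  have h1 : frobSq G = ∑ i, ∑ j, (if i = j then 0 else G i j) ^ 2 + ∑ i, G i i ^ 2 := by
    rw [frobSq, ← Finset.sum_add_distrib]
    refine Finset.sum_congr rfl fun i _ => ?_
    have : G i i ^ 2 = ∑ j, if i = j then G i j ^ 2 else 0 := by simp
    rw [this, ← Finset.sum_add_distrib]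
    refine Finset.sum_congr rfl fun j _ => ?_
    split_ifs <;> simp
  have h2 : G.trace ^ 2 / n ≤ ∑ i, G i i ^ 2 := by
    rw [div_le_iff₀' (by positivity)]
    simpa [trace] using sq_sum_le_card_mul_sum_sq (s := Finset.univ) (f := fun i => G i i)
  linarith

/-- Fluctuation of `‖y‖² / n` given the design. -/
theorem frobSq_model_one_le (hn : 0 < n) (X : Matrix (Fin n) (Fin p) ℝ) :
    frobSq ((modelMatrix X)ᵀ * (1 : Matrix (Fin n) (Fin n) ℝ) * modelMatrix X) ≤
      2 * n ^ 2 * ((1 + (n / p : ℝ) ^ 2) * (1 / n + frobSq (X * Xᵀ * (X * Xᵀ)) / n ^ 6)) := by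
  have hs : (X * Xᵀ).IsSymm := by simp [IsSymm]
  rw [frobSq_conj_eq (by simp [IsSymm]) (Commute.one_left _), modelMatrix_mul_transpose,
    Matrix.mul_one]
  have h1 := frobSq_add_le (1 : Matrix (Fin n) (Fin n) ℝ) ((p : ℝ)⁻¹ • (X * Xᵀ))
  -- With `p` of order `n`, the diagonal entries of `(X Xᵀ)²` are typically of order `n²`.
  have h2 := frobSq_le_frobSq_sq hs (t := (n : ℝ) ^ 2) (by positivity)
  rw [frobSq_one, frobSq_smul, Fintype.card_fin] at h1
  rw [Fintype.card_fin] at h2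
  set F := frobSq (X * Xᵀ * (X * Xᵀ))
  have hF : 0 ≤ F := frobSq_nonneg _
  refine h1.trans ?_
  calc 2 * (n : ℝ) + 2 * ((p : ℝ)⁻¹ ^ 2 * frobSq (X * Xᵀ))
      ≤ 2 * (n : ℝ) + 2 * ((p : ℝ)⁻¹ ^ 2 * (n ^ 2 * n / 2 + F / (2 * n ^ 2))) := by gcongr
    _ ≤ 2 * n ^ 2 * ((1 + (n / p : ℝ) ^ 2) * (1 / n + F / n ^ 6)) := by
      have e : 2 * (n : ℝ) ^ 2 * ((1 + (n / p : ℝ) ^ 2) * (1 / n + F / n ^ 6)) -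
          (2 * (n : ℝ) + 2 * ((p : ℝ)⁻¹ ^ 2 * (n ^ 2 * n / 2 + F / (2 * n ^ 2)))) =
          2 * F / n ^ 4 + (p : ℝ)⁻¹ ^ 2 * (n ^ 3 + F / n ^ 2) := by
        rw [div_pow, inv_pow]
        field_simp
        ring
      have : 0 ≤ 2 * F / n ^ 4 + (p : ℝ)⁻¹ ^ 2 * (n ^ 3 + F / n ^ 2) := by positivity
      linarith

/-- Fluctuation of `‖Xᵀ y‖² / n²` given the design. -/
theorem frobSq_model_gram_le (hn : 0 < n) (X : Matrix (Fin n) (Fin p) ℝ) :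
    frobSq ((modelMatrix X)ᵀ * (X * Xᵀ) * modelMatrix X) ≤
      2 * n ^ 4 * ((1 + (n / p : ℝ) ^ 2) * (1 / n + frobSq (X * Xᵀ * (X * Xᵀ)) / n ^ 6)) := by
  have hs : (X * Xᵀ).IsSymm := by simp [IsSymm]
  have hc : Commute (X * Xᵀ) (modelMatrix X * (modelMatrix X)ᵀ) := by
    rw [modelMatrix_mul_transpose]
    exact (Commute.one_right _).add_right ((Commute.refl _).smul_right _)
  rw [frobSq_conj_eq hs hc, modelMatrix_mul_transpose, Matrix.add_mul, Matrix.one_mul,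
    Matrix.smul_mul]
  have h1 := frobSq_add_le (X * Xᵀ) ((p : ℝ)⁻¹ • (X * Xᵀ * (X * Xᵀ)))
  have h2 := frobSq_le_frobSq_sq hs (t := (n : ℝ) ^ 2) (by positivity)
  rw [frobSq_smul] at h1
  rw [Fintype.card_fin] at h2
  set F := frobSq (X * Xᵀ * (X * Xᵀ))
  have hF : 0 ≤ F := frobSq_nonneg _
  refine h1.trans ?_
  calc 2 * frobSq (X * Xᵀ) + 2 * ((p : ℝ)⁻¹ ^ 2 * F)
      ≤ 2 * ((n : ℝ) ^ 2 * n / 2 + F / (2 * n ^ 2)) + 2 * ((p : ℝ)⁻¹ ^ 2 * F) := by gcongr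
    _ ≤ 2 * n ^ 4 * ((1 + (n / p : ℝ) ^ 2) * (1 / n + F / n ^ 6)) := by
      have e : 2 * (n : ℝ) ^ 4 * ((1 + (n / p : ℝ) ^ 2) * (1 / n + F / n ^ 6)) -
          (2 * ((n : ℝ) ^ 2 * n / 2 + F / (2 * n ^ 2)) + 2 * ((p : ℝ)⁻¹ ^ 2 * F)) =
          n ^ 3 + F / n ^ 2 + (p : ℝ)⁻¹ ^ 2 * (2 * n ^ 5) := by
        rw [div_pow, inv_pow]
        field_simp
        ring
      have : 0 ≤ n ^ 3 + F / n ^ 2 + (p : ℝ)⁻¹ ^ 2 * (2 * n ^ 5) := by positivity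
      linarith

end LinearModel

/-! ### The Gram matrix: splitting into diagonal and off-diagonal parts -/

section GramMatrix

open Matrix

variable {n p : ℕ} {S : Matrix (Fin p) (Fin p) ℝ} {C : ℝ}

theorem Matrix.PosSemidef.isSymm (hS : S.PosSemidef) : S.IsSymm := by
  have := hS.isHermitian.eq
  rwa [conjTranspose_eq_transpose_of_trivial] at this

theorem design_mul_transpose (hS : S.PosSemidef) (z : Fin n → Fin p → ℝ) :
    design z S * (design z S)ᵀ = of fun i j => rowForm S z i j := by
  open scoped MatrixOrder in
  have h0 : (0 : Matrix (Fin p) (Fin p) ℝ) ≤ S := Matrix.nonneg_iff_posSemidef.2 hS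
  open scoped MatrixOrder in
  have hsq : psdSqrt S * psdSqrt S = S := CFC.sqrt_mul_sqrt_self S h0
  open scoped MatrixOrder in
  have hsymm : (psdSqrt S)ᵀ = psdSqrt S := by
    have : (psdSqrt S).PosSemidef := Matrix.nonneg_iff_posSemidef.1 (CFC.sqrt_nonneg S)
    simpa using this.isHermitian.eq
  have hST : S.IsSymm := hS.isSymm
  rw [design, transpose_mul, hsymm, Matrix.mul_assoc, ← Matrix.mul_assoc (psdSqrt S), hsq]
  ext i j
  simp only [of_apply, rowForm, mul_apply, transpose_apply, Finset.mul_sum, Finset.sum_mul]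
  rw [Finset.sum_comm]
  refine Finset.sum_congr rfl fun a _ => Finset.sum_congr rfl fun b _ => ?_
  rw [← hST.apply]
  ring

theorem OpBound.trace_sq_le (h : OpBound S C) : S.trace ^ 2 ≤ C ^ 2 * p ^ 2 := by
  have h1 : S.trace ^ 2 ≤ p * ∑ i, S i i ^ 2 := by
    simpa [trace] using sq_sum_le_card_mul_sum_sq (s := Finset.univ) (f := fun i => S i i)
  have h2 : ∑ i, S i i ^ 2 ≤ frobSq S :=
    Finset.sum_le_sum fun i _ => Finset.single_le_sum (f := fun j => S i j ^ 2)
      (fun j _ => sq_nonneg _) (Finset.mem_univ i)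
  calc S.trace ^ 2 ≤ p * (C ^ 2 * p) := h1.trans (by gcongr; exact h2.trans h.frobSq_le)
    _ = _ := by ring

/-- The fourth spectral moment of the Gram matrix in terms of the fluctuations of its diagonal and
the fourth spectral moment of its off-diagonal part. -/
theorem frobSq_gram_sq_le (hS : S.IsSymm) (hC : OpBound S C) (z : Fin n → Fin p → ℝ) :
    frobSq ((of fun i j => rowForm S z i j) * (of fun i j => rowForm S z i j)) ≤
      64 * (n * (C ^ 4 * p ^ 4) + (∑ i, (rowForm S z i i - S.trace) ^ 2) ^ 2) +
        8 * ∑ i, ∑ k, (∑ j, offForm S z i j * offForm S z j k) ^ 2 := by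
  set D : Matrix (Fin n) (Fin n) ℝ := diagonal fun i => rowForm S z i i
  set O : Matrix (Fin n) (Fin n) ℝ := of fun i j => offForm S z i j
  have e : (of fun i j => rowForm S z i j) = D + O := by
    ext i j
    by_cases hij : i = j
    · simp [D, O, offForm, hij]
    · simp [D, O, offForm, hij, diagonal_apply_ne]
  have hO : O.IsSymm := by
    ext i j
    simp [O, offForm_comm hS z j i]
  have h1 := frobSq_sq_add_le (D := D) (O := O) (isSymm_diagonal _) hO
  have h2 : frobSq (O * O) = ∑ i, ∑ k, (∑ j, offForm S z i j * offForm S z j k) ^ 2 := by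
    simp [frobSq, mul_apply, O]
  have h3 : frobSq (D * D) = ∑ i, rowForm S z i i ^ 4 := by
    simp only [D, diagonal_mul_diagonal, frobSq]
    refine Finset.sum_congr rfl fun i _ => ?_
    rw [Finset.sum_eq_single i]
    · simp; ring
    · intro j _ hj
      simp [diagonal_apply_ne _ hj.symm]
    · simp
  have h4 : ∑ i, rowForm S z i i ^ 4 ≤
      8 * (n * (C ^ 4 * p ^ 4) + (∑ i, (rowForm S z i i - S.trace) ^ 2) ^ 2) := by
    set δ : Fin n → ℝ := fun i => rowForm S z i i - S.trace
    have hT : S.trace ^ 4 ≤ C ^ 4 * p ^ 4 := by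
      have := pow_le_pow_left₀ (sq_nonneg _) hC.trace_sq_le 2
      nlinarith
    have a1 : ∀ i, rowForm S z i i ^ 4 ≤ 8 * (C ^ 4 * p ^ 4) + 8 * (δ i ^ 2) ^ 2 := by
      intro i
      have e : rowForm S z i i = S.trace + δ i := by simp [δ]
      rw [e]
      have : (S.trace + δ i) ^ 4 ≤ 8 * S.trace ^ 4 + 8 * (δ i ^ 2) ^ 2 := by
        have b1 : (S.trace + δ i) ^ 2 ≤ 2 * (S.trace ^ 2 + δ i ^ 2) := by
          nlinarith [sq_nonneg (S.trace - δ i)]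
        have b2 := pow_le_pow_left₀ (sq_nonneg _) b1 2
        nlinarith [sq_nonneg (S.trace ^ 2 - δ i ^ 2)]
      linarith
    -- Fourth powers of the deviations are controlled by the square of `∑ δᵢ²`. Markov's inequality
    -- is later applied to that sum itself, so no eighth moments of the entries are required.
    have a2 : ∑ i, (δ i ^ 2) ^ 2 ≤ (∑ i, δ i ^ 2) ^ 2 :=
      Finset.sum_sq_le_sq_sum_of_nonneg fun i _ => sq_nonneg _
    calc ∑ i, rowForm S z i i ^ 4 ≤ ∑ i, (8 * (C ^ 4 * p ^ 4) + 8 * (δ i ^ 2) ^ 2) :=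
          Finset.sum_le_sum fun i _ => a1 i
      _ = 8 * (n * (C ^ 4 * p ^ 4)) + 8 * ∑ i, (δ i ^ 2) ^ 2 := by
          rw [Finset.sum_add_distrib, Finset.mul_sum]
          simp; ring
      _ ≤ _ := by linarith
  rw [e]
  rw [h2, h3] at h1
  linarith

theorem trace_gram_sq_le (hC : OpBound S C) (z : Fin n → Fin p → ℝ) :
    (∑ i, rowForm S z i i) ^ 2 ≤
      2 * n * (n * (C ^ 2 * p ^ 2) + ∑ i, (rowForm S z i i - S.trace) ^ 2) := by
  have h1 : (∑ i, rowForm S z i i) ^ 2 ≤ n * ∑ i, rowForm S z i i ^ 2 := by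
    simpa using sq_sum_le_card_mul_sum_sq (s := Finset.univ) (f := fun i => rowForm S z i i)
  have h2 : ∑ i, rowForm S z i i ^ 2 ≤
      ∑ i, (2 * (C ^ 2 * p ^ 2) + 2 * (rowForm S z i i - S.trace) ^ 2) :=
    Finset.sum_le_sum fun i _ => by
      nlinarith [hC.trace_sq_le, sq_nonneg (rowForm S z i i - 2 * S.trace)]
  simp only [Finset.sum_add_distrib, ← Finset.mul_sum, Finset.sum_const, Finset.card_univ,
    Fintype.card_fin, nsmul_eq_mul] at h2
  calc _ ≤ (n : ℝ) * (n * (2 * (C ^ 2 * p ^ 2)) + 2 * ∑ i, (rowForm S z i i - S.trace) ^ 2) :=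
        h1.trans (mul_le_mul_of_nonneg_left (h2.trans (by linarith)) (by positivity))
    _ = _ := by ring

end GramMatrix

/-! ### Spectral distribution: operator bound and lower bound on the second moment -/

section Spectrum

open Matrix

variable {p : ℕ} {S : Matrix (Fin p) (Fin p) ℝ}

/-- Orthogonal diagonalization of a positive semidefinite matrix. -/
theorem Matrix.PosSemidef.exists_diagonalization (hS : S.PosSemidef) :
    ∃ (U : Matrix (Fin p) (Fin p) ℝ) (l : Fin p → ℝ), Uᵀ * U = 1 ∧ U * Uᵀ = 1 ∧
      S = U * diagonal l * Uᵀ ∧ (∀ i, 0 ≤ l i) ∧ eigs S = Finset.univ.val.map l := by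
  have hA := hS.isHermitian
  have hstar : ∀ B : Matrix (Fin p) (Fin p) ℝ, star B = Bᵀ := fun B => by
    rw [star_eq_conjTranspose, conjTranspose_eq_transpose_of_trivial]
  refine ⟨hA.eigenvectorUnitary, hA.eigenvalues, ?_, ?_, ?_, hS.eigenvalues_nonneg, ?_⟩
  · rw [← hstar]; exact Unitary.coe_star_mul_self _
  · rw [← hstar]; exact Unitary.coe_mul_star_self _
  · conv_lhs => rw [hA.spectral_theorem, Unitary.conjStarAlgAut_apply]
    rw [hstar]
    rfl
  · rw [eigs, hA.roots_charpoly_eq_eigenvalues]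
    rfl

/-- In an orthonormal eigenbasis `S` multiplies each coordinate by a factor in `[0, C]`; positivity
is what turns the one-sided bound into a bound on squares. -/
theorem opBound_of_eigs_le (hS : S.PosSemidef) {C : ℝ} (hC : ∀ s ∈ eigs S, s ≤ C) :
    OpBound S C := by
  obtain ⟨U, l, h1, h2, hSU, hl, he⟩ := hS.exists_diagonalization
  have hlC : ∀ i, l i ≤ C := fun i => hC _ (by rw [he]; simp)
  intro v
  have hiso : ∀ B : Matrix (Fin p) (Fin p) ℝ, Bᵀ * B = 1 → ∀ x : Fin p → ℝ,
      ∑ a, (B *ᵥ x) a ^ 2 = ∑ a, x a ^ 2 := by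
    intro B hB x
    have : (B *ᵥ x) ⬝ᵥ (B *ᵥ x) = x ⬝ᵥ x := by
      rw [dotProduct_mulVec, ← mulVec_transpose, mulVec_mulVec, hB, one_mulVec]
    simpa only [dotProduct, ← sq] using this
  change ∑ a, (S *ᵥ v) a ^ 2 ≤ _
  rw [hSU, ← mulVec_mulVec, ← mulVec_mulVec, hiso U h1, ← hiso Uᵀ (by simpa using h2) v,
    Finset.mul_sum]
  refine Finset.sum_le_sum fun a _ => ?_
  rw [mulVec_diagonal, mul_pow]
  exact mul_le_mul_of_nonneg_right (pow_le_pow_left₀ (hl a) (hlC a) 2) (sq_nonneg _)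

theorem Matrix.PosSemidef.exists_frobSq_eq (hS : S.PosSemidef) :
    ∃ l : Fin p → ℝ, (∀ i, 0 ≤ l i) ∧ eigs S = Finset.univ.val.map l ∧
      frobSq S = ∑ i, l i ^ 2 := by
  obtain ⟨U, l, h1, h2, hSU, hl, he⟩ := hS.exists_diagonalization
  refine ⟨l, hl, he, ?_⟩
  rw [frobSq_eq_trace, hS.isSymm.eq]
  conv_lhs => rw [hSU]
  rw [show U * diagonal l * Uᵀ * (U * diagonal l * Uᵀ) =
    U * (diagonal l * (Uᵀ * U) * diagonal l * Uᵀ) by simp only [Matrix.mul_assoc], h1,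
    Matrix.mul_one, trace_mul_comm, Matrix.mul_assoc, h1, Matrix.mul_one, diagonal_mul_diagonal,
    trace_diagonal]
  simp only [sq]

theorem empSpecDist_eq (l : Fin p → ℝ) (he : eigs S = Finset.univ.val.map l) (x : ℝ) :
    empSpecDist S x = (Finset.univ.filter fun i => l i ≤ x).card / p := by
  classical
  rw [empSpecDist, he, Multiset.countP_map]
  congr 2

/-- A lower bound for the second spectral moment in terms of the spectral distribution. -/
theorem le_frobSq_of_empSpecDist (hS : S.PosSemidef) (hp : 0 < p) {x : ℝ} (hx : 0 ≤ x) :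
    x ^ 2 * (1 - empSpecDist S x) * p ≤ frobSq S := by
  classical
  obtain ⟨l, hl, he, hF⟩ := hS.exists_frobSq_eq
  have hp' : (p : ℝ) ≠ 0 := by positivity
  have hcard : ((Finset.univ.filter fun i => l i ≤ x).card : ℝ) +
      (Finset.univ.filter fun i => ¬ l i ≤ x).card = p := by
    have := Finset.card_filter_add_card_filter_not (s := (Finset.univ : Finset (Fin p)))
      (fun i => l i ≤ x)
    rw [Finset.card_univ, Fintype.card_fin] at this
    exact_mod_cast this
  rw [empSpecDist_eq l he, hF]
  calc x ^ 2 * (1 - ((Finset.univ.filter fun i => l i ≤ x).card : ℝ) / p) * p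
      = ∑ i ∈ Finset.univ.filter fun i => ¬ l i ≤ x, x ^ 2 := by
        rw [Finset.sum_const, nsmul_eq_mul]
        field_simp
        linear_combination -x ^ 2 * hcard
    _ ≤ ∑ i ∈ Finset.univ.filter fun i => ¬ l i ≤ x, l i ^ 2 :=
        Finset.sum_le_sum fun i hi => by
          have := (Finset.mem_filter.1 hi).2
          exact pow_le_pow_left₀ hx (not_le.1 this).le 2
    _ ≤ ∑ i, l i ^ 2 :=
        Finset.sum_le_sum_of_subset_of_nonneg (Finset.filter_subset _ _) fun _ _ _ => sq_nonneg _

theorem ne_zero_of_empSpecDist_zero_ne_one (hS : S.PosSemidef) (hp : 0 < p)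
    (h : empSpecDist S 0 ≠ 1) : S ≠ 0 := by
  rintro rfl
  obtain ⟨l, hl, he, hF⟩ := hS.exists_frobSq_eq
  have h0 : ∀ i, l i = 0 := by
    have : ∑ i, l i ^ 2 = 0 := by rw [← hF]; simp [frobSq]
    intro i
    have := (Finset.sum_eq_zero_iff_of_nonneg fun i _ => sq_nonneg (l i)).1 this i
      (Finset.mem_univ i)
    exact pow_eq_zero_iff (two_ne_zero) |>.1 this
  apply h
  rw [empSpecDist_eq l he]
  have hp' : (p : ℝ) ≠ 0 := by positivity
  simp [h0, hp']

/-- A distribution function with value different from one at zero is smaller than one at some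
positive continuity point. -/
theorem exists_continuousAt_cdf_lt_one {H : Measure ℝ} [IsProbabilityMeasure H]
    (h0 : cdf H 0 ≠ 1) : ∃ x, 0 < x ∧ ContinuousAt (cdf H) x ∧ cdf H x < 1 := by
  have hlt : cdf H 0 < 1 := lt_of_le_of_ne (cdf_le_one H 0) h0
  have hrc := (cdf H).right_continuous 0
  have hev : ∀ᶠ y in 𝓝[≥] (0 : ℝ), cdf H y < 1 := hrc.eventually_lt_const hlt
  obtain ⟨δ, hδ, hsub⟩ := mem_nhdsGE_iff_exists_Ico_subset.1 hev
  have hδ' : (0 : ℝ) < δ := hδ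
  -- A monotone function has countably many discontinuities, so continuity points are dense and one
  -- lies in the interval `(0, δ)` found by right continuity.
  have hc := (monotone_cdf H).countable_not_continuousAt
  obtain ⟨x, hx1, hx2⟩ := (hc.dense_compl ℝ).exists_mem_open isOpen_Ioo
    (Set.nonempty_Ioo.2 hδ')
  refine ⟨x, hx2.1, ?_, hsub ⟨hx2.1.le, hx2.2⟩⟩
  by_contra hcon
  exact hx1 hcon

/-- The second spectral moments stay away from zero if the limiting spectral distribution is not
concentrated at zero. -/
theorem eventually_le_frobSq {p : ℕ → ℕ} (hp : ∀ n, 2 ≤ n → 2 ≤ p n)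
    {S : (n : ℕ) → Matrix (Fin (p n)) (Fin (p n)) ℝ} (hS : ∀ n, 2 ≤ n → (S n).PosSemidef)
    {H : Measure ℝ} [IsProbabilityMeasure H]
    (hHlim : ∀ x : ℝ, ContinuousAt (cdf H) x →
      Tendsto (fun n => empSpecDist (S n) x) atTop (𝓝 (cdf H x)))
    (hH0 : cdf H 0 ≠ 1) : ∃ c > 0, ∀ᶠ n in atTop, c * p n ≤ frobSq (S n) := by
  obtain ⟨x, hx, hc, hlt⟩ := exists_continuousAt_cdf_lt_one hH0
  -- Eventually the spectral distribution at `x` is below the midpoint of `cdf H x` and 1, so a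
  -- fraction of at least `(1 - cdf H x) / 2` of the eigenvalues exceeds `x`.
  refine ⟨x ^ 2 * ((1 - cdf H x) / 2), mul_pos (by positivity) (by linarith), ?_⟩
  have hlt' : cdf H x < (1 + cdf H x) / 2 := by linarith
  filter_upwards [(hHlim x hc).eventually_lt_const hlt', eventually_ge_atTop 2] with n hn h2
  have := le_frobSq_of_empSpecDist (hS n h2) (by have := hp n h2; omega) hx.le
  refine le_trans ?_ this
  gcongr
  linarith

end Spectrum

/-! ### Almost sure positivity of `m̃₂` -/

section AlmostSure

open Matrix

variable {Ω : Type*} [MeasurableSpace Ω] {P : Measure Ω} [IsProbabilityMeasure P]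
  {n p : ℕ} {S : Matrix (Fin p) (Fin p) ℝ} {M : ℝ} {Z : Ω → Fin n → Fin p → ℝ}

/-- Absolute continuity is used twice: a nonzero row of `S` makes `S zᵢ ≠ 0` almost surely, and then
the form is a nontrivial linear form in the independent row `j`. -/
theorem StdEntries.measure_rowForm_eq_zero (h : StdEntries Z P M)
    (hac : ∀ i j, P.map (fun ω => Z ω i j) ≪ volume) (hS0 : S ≠ 0) {i j : Fin n} (hij : i ≠ j) :
    P {ω | rowForm S (Z ω) i j = 0} = 0 := by
  have hrow : ∃ a, S a ≠ 0 := by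
    by_contra! hcon
    exact hS0 (funext hcon)
  obtain ⟨a, ha⟩ := hrow
  have h1 := measure_linearForm_eq_zero (h.row i).meas (h.row i).indep (hac i) ha
  have h2 := (h.indep_rows.indepFun hij.symm).measure_eq_zero_of_forall
    (h.measurable_row j) (h.measurable_row i)
    (A := {x | ∑ a, (∑ b, S a b * x.2 b) * x.1 a = 0})
    (measurableSet_eq_fun (by fun_prop) (by fun_prop)) (by
      have h1' : ∀ᵐ ω ∂P, ¬ ∑ b, S a b * Z ω i b = 0 := measure_eq_zero_iff_ae_notMem.1 h1
      filter_upwards [h1'] with ω' hω'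
      refine measure_linearForm_eq_zero (h.row j).meas (h.row j).indep (hac j)
        (v := fun a => ∑ b, S a b * Z ω' i b) fun hv => hω' ?_
      exact congrFun hv a)
  exact h2

/-- The variance-type statistic of the design is almost surely positive. -/
theorem StdEntries.ae_mTilde2_pos (h : StdEntries Z P M) (hn : 2 ≤ n) (hp : 0 < p)
    (hS : S.PosSemidef) (hS0 : S ≠ 0) (hac : ∀ i j, P.map (fun ω => Z ω i j) ≪ volume) :
    ∀ᵐ ω ∂P, 0 < mTilde2 (design (Z ω) S) := by
  set i : Fin n := ⟨0, by omega⟩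
  set j : Fin n := ⟨1, by omega⟩
  have hij : i ≠ j := by simp [i, j]
  have h1 : ∀ᵐ ω ∂P, ¬ rowForm S (Z ω) i j = 0 :=
    measure_eq_zero_iff_ae_notMem.1 (h.measure_rowForm_eq_zero hac hS0 hij)
  filter_upwards [h1] with ω hω
  refine lt_of_lt_of_le ?_ (sum_sq_offDiag_le_mTilde2 (by omega) hp _)
  rw [design_mul_transpose hS]
  refine div_pos ?_ (by have : 0 < n := by omega
                        positivity)
  refine Finset.sum_pos' (fun _ _ => Finset.sum_nonneg fun _ _ => sq_nonneg _)
    ⟨i, Finset.mem_univ _, Finset.sum_pos' (fun _ _ => sq_nonneg _) ⟨j, Finset.mem_univ _, ?_⟩⟩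
  rw [if_neg hij]
  have : (of fun i j => rowForm S (Z ω) i j) i j ≠ 0 := hω
  positivity

end AlmostSure

/-! ### Events of probability tending to one -/

section Likely

variable {Ω : Type*} [MeasurableSpace Ω] {P : Measure Ω} [IsProbabilityMeasure P]

/-- The events `E n` have probability tending to one. -/
def Likely (P : Measure Ω) (E : ℕ → Ω → Prop) : Prop :=
  Tendsto (fun n => P.real {ω | ¬ E n ω}) atTop (𝓝 0)

theorem Likely.mono {E F : ℕ → Ω → Prop} (h : Likely P E)
    (hEF : ∀ᶠ n in atTop, ∀ ω, E n ω → F n ω) : Likely P F := by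
  refine tendsto_of_tendsto_of_tendsto_of_le_of_le' tendsto_const_nhds h
    (Eventually.of_forall fun n => measureReal_nonneg) ?_
  filter_upwards [hEF] with n hn
  exact measureReal_mono fun ω hω hE => hω (hn ω hE)

theorem Likely.and {E F : ℕ → Ω → Prop} (hE : Likely P E) (hF : Likely P F) :
    Likely P fun n ω => E n ω ∧ F n ω := by
  have := Tendsto.add hE hF
  rw [add_zero] at this
  refine tendsto_of_tendsto_of_tendsto_of_le_of_le tendsto_const_nhds this
    (fun n => measureReal_nonneg) fun n => ?_
  refine le_trans (measureReal_mono fun ω hω => ?_) (measureReal_union_le _ _)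
  by_cases h : E n ω
  · exact Or.inr fun hf => hω ⟨h, hf⟩
  · exact Or.inl h

/-- Markov's inequality for nonnegative variables with expectations of order `1 / n`. -/
theorem Likely.of_integral_le {f : ℕ → Ω → ℝ} {K : ℝ} (h0 : ∀ n ω, 0 ≤ f n ω)
    (h : ∀ᶠ n : ℕ in atTop, Integrable (f n) P ∧ ∫ ω, f n ω ∂P ≤ K / n) {η : ℝ} (hη : 0 < η) :
    Likely P fun n ω => f n ω ≤ η := by
  have hlim : Tendsto (fun n : ℕ => K / n / η) atTop (𝓝 0) := by
    simpa using (tendsto_const_div_atTop_nhds_zero_nat K).div_const η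
  refine tendsto_of_tendsto_of_tendsto_of_le_of_le' tendsto_const_nhds hlim
    (Eventually.of_forall fun n => measureReal_nonneg) ?_
  filter_upwards [h] with n hn
  have := mul_meas_ge_le_integral_of_nonneg (ae_of_all _ (h0 n)) hn.1 η
  rw [le_div_iff₀' hη]
  refine le_trans (mul_le_mul_of_nonneg_left (measureReal_mono fun ω hω => ?_) hη.le)
    (this.trans hn.2)
  exact (not_le.1 hω).le

/-- Chebyshev's inequality conditionally on an independent random element. -/
theorem measureReal_not_abs_lt_le {α γ : Type*} [MeasurableSpace α] [MeasurableSpace γ]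
    {X : Ω → α} {Y : Ω → γ} (h : IndepFun X Y P) (hX : Measurable X) (hY : Measurable Y)
    {φ : α → γ → ℝ} (hφ : Measurable fun x : α × γ => φ x.1 x.2) {V : γ → ℝ} (hV : Measurable V)
    {K : ℝ} (hK : 0 ≤ K)
    (hφV : ∀ y, Integrable (fun ω => φ (X ω) y ^ 2) P ∧ ∫ ω, φ (X ω) y ^ 2 ∂P ≤ K * V y)
    {η κ : ℝ} (hη : 0 < η) (hκ : 0 < κ) :
    P.real {ω | ¬ |φ (X ω) (Y ω)| < κ} ≤ P.real {ω | ¬ V (Y ω) ≤ η} + K * η / κ ^ 2 := by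
  classical
  have hset : MeasurableSet {x : α × γ | V x.2 ≤ η} :=
    measurableSet_le (hV.comp measurable_snd) measurable_const
  have hf0 : ∀ x : α × γ, 0 ≤ {x : α × γ | V x.2 ≤ η}.indicator (fun x => φ x.1 x.2 ^ 2) x :=
    fun x => Set.indicator_nonneg (fun _ _ => sq_nonneg _) _
  -- Truncating to `V ≤ η` bounds the conditional second moment by the constant `K * η`, so no
  -- integrability of `V (Y ω)` is required.
  obtain ⟨hi, hle⟩ := h.integrable_and_integral_le hX hY
    (f := {x : α × γ | V x.2 ≤ η}.indicator (fun x => φ x.1 x.2 ^ 2))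
    ((hφ.pow_const 2).indicator hset) hf0 (G := fun _ => K * η) (integrable_const _)
    (fun ω' => by
      by_cases hω : V (Y ω') ≤ η
      · have e : ∀ ω, {x : α × γ | V x.2 ≤ η}.indicator (fun x => φ x.1 x.2 ^ 2) (X ω, Y ω') =
            φ (X ω) (Y ω') ^ 2 := fun ω => Set.indicator_of_mem (by exact hω) _
        simp_rw [e]
        exact ⟨(hφV _).1, (hφV _).2.trans (mul_le_mul_of_nonneg_left hω hK)⟩
      · have e : ∀ ω, {x : α × γ | V x.2 ≤ η}.indicator (fun x => φ x.1 x.2 ^ 2) (X ω, Y ω') =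
            0 := fun ω => Set.indicator_of_notMem (by exact hω) _
        simp_rw [e]
        exact ⟨integrable_const _, by simp; positivity⟩)
  have hmarkov := mul_meas_ge_le_integral_of_nonneg (ae_of_all _ fun ω => hf0 (X ω, Y ω)) hi (κ ^ 2)
  have hle' : P.real {ω | κ ^ 2 ≤ {x : α × γ | V x.2 ≤ η}.indicator (fun x => φ x.1 x.2 ^ 2)
      (X ω, Y ω)} ≤ K * η / κ ^ 2 := by
    rw [le_div_iff₀' (by positivity)]
    refine hmarkov.trans (hle.trans ?_)
    simp
  refine le_trans (le_trans (measureReal_mono fun ω hω => ?_) (measureReal_union_le _ _))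
    (add_le_add_right hle' (P.real {ω | ¬ V (Y ω) ≤ η}))
  by_cases hv : V (Y ω) ≤ η
  · right
    have e : {x : α × γ | V x.2 ≤ η}.indicator (fun x => φ x.1 x.2 ^ 2) (X ω, Y ω) =
        φ (X ω) (Y ω) ^ 2 := Set.indicator_of_mem (by exact hv) _
    have : κ ≤ |φ (X ω) (Y ω)| := not_lt.1 hω
    change κ ^ 2 ≤ _
    rw [e, ← sq_abs (φ _ _)]
    exact pow_le_pow_left₀ hκ.le this 2
  · exact Or.inl hv

/-- The truncation level `η` is free, so it can be chosen after the target probability and the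
tolerance `κ`. -/
theorem Likely.abs_lt_of_le {φ V : ℕ → Ω → ℝ} {K : ℝ} (hK : 0 ≤ K)
    (h : ∀ᶠ n in atTop, ∀ η > 0, ∀ κ > 0,
      P.real {ω | ¬ |φ n ω| < κ} ≤ P.real {ω | ¬ V n ω ≤ η} + K * η / κ ^ 2)
    (hV : ∀ η > 0, Likely P fun n ω => V n ω ≤ η) {κ : ℝ} (hκ : 0 < κ) :
    Likely P fun n ω => |φ n ω| < κ := by
  rw [Likely, Metric.tendsto_atTop']
  intro e he
  -- Chosen so that the Chebyshev term is at most `e / 2`; `K + 1` keeps the denominator positive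
  -- when `K = 0`.
  set η : ℝ := e * κ ^ 2 / (2 * (K + 1)) with hη
  have hη0 : 0 < η := by positivity
  have hKe : K * η / κ ^ 2 ≤ e / 2 := by
    rw [div_le_iff₀ (by positivity), hη, mul_div_assoc', div_le_iff₀ (by positivity)]
    have : 0 ≤ e * κ ^ 2 := by positivity
    nlinarith
  have hev := (hV η hη0).eventually_lt_const (half_pos he)
  obtain ⟨N, hN⟩ := eventually_atTop.1 (hev.and h)
  refine ⟨N, fun n hn => ?_⟩
  obtain ⟨h1, h2⟩ := hN n hn.le
  rw [Real.dist_eq, sub_zero, abs_of_nonneg measureReal_nonneg]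
  linarith [h2 η hη0 κ hκ]

theorem tendstoInMeasure_of_likely {f : ℕ → Ω → ℝ} {a : ℝ}
    (h : ∀ δ > 0, Likely P fun n ω => |f n ω - a| < δ) :
    TendstoInMeasure P f atTop fun _ => a := by
  rw [tendstoInMeasure_iff_measureReal_norm]
  intro δ hδ
  refine (h δ hδ).congr fun n => ?_
  simp only [not_lt, Real.norm_eq_abs]

end Likely

/-! ### Conditional deviations of the quadratic statistics -/

section Model

open Matrix

variable {Ω : Type*} [MeasurableSpace Ω] {P : Measure Ω} [IsProbabilityMeasure P]
  {n p : ℕ} {M σ τ : ℝ}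

/-- The size of the conditional fluctuations of the quadratic statistics given the design. -/
noncomputable def designFluct (X : Matrix (Fin n) (Fin p) ℝ) : ℝ :=
  (1 + (n / p : ℝ) ^ 2) * (1 / n + frobSq (X * Xᵀ * (X * Xᵀ)) / n ^ 6)

/-- The deviation of `‖y‖² / n` from its conditional mean. -/
noncomputable def devNorm (σ τ : ℝ) (X : Matrix (Fin n) (Fin p) ℝ) (y : Fin n → ℝ) : ℝ :=
  sqNorm y / n - (σ ^ 2 + τ ^ 2 * mHat1 X)

/-- The deviation of `‖Xᵀ y‖² / n²` from its conditional mean. -/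
noncomputable def devGram (σ τ : ℝ) (X : Matrix (Fin n) (Fin p) ℝ) (y : Fin n → ℝ) : ℝ :=
  sqNorm (Xᵀ *ᵥ y) / (n : ℝ) ^ 2 - (σ ^ 2 * ((p : ℝ) / n * mHat1 X) + τ ^ 2 * mHat2 X)

/-- The assumptions on the noise and the random effects. -/
structure ModelNoise (β : Ω → Fin p → ℝ) (u : Ω → Fin n → ℝ) (P : Measure Ω) (σ τ M : ℝ) :
    Prop where
  centered : IndepCentered (fun i ω => modelVector (β ω) (u ω) i) P M
  noise_sq : ∀ i, ∫ ω, u ω i ^ 2 ∂P = σ ^ 2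
  effect_sq : ∀ j, ∫ ω, (√(p : ℝ) * β ω j) ^ 2 ∂P = τ ^ 2

variable {β : Ω → Fin p → ℝ} {u : Ω → Fin n → ℝ}

/-- For a fixed design the squared norm is a quadratic form in `modelVector`, so the variance bound
applies and the subtracted term is its mean. Both statistics are instances: `A = 1` gives `‖y‖²` and
`A = Xᵀ` gives `‖Xᵀ y‖²`. -/
theorem ModelNoise.integral_sqNorm_sub_sq_le (h : ModelNoise β u P σ τ M) (hp : 0 < p) {k : ℕ}
    (X : Matrix (Fin n) (Fin p) ℝ) (A : Matrix (Fin k) (Fin n) ℝ) (c : ℝ) :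
    Integrable (fun ω => (c * sqNorm (A *ᵥ response X (β ω) (u ω)) - c * (σ ^ 2 * (Aᵀ * A).trace
      + τ ^ 2 * ((p : ℝ)⁻¹ * (X * Xᵀ * (Aᵀ * A)).trace))) ^ 2) P ∧
    ∫ ω, (c * sqNorm (A *ᵥ response X (β ω) (u ω)) - c * (σ ^ 2 * (Aᵀ * A).trace
      + τ ^ 2 * ((p : ℝ)⁻¹ * (X * Xᵀ * (Aᵀ * A)).trace))) ^ 2 ∂P ≤
      8 * M ^ 2 * (c ^ 2 * frobSq ((modelMatrix X)ᵀ * (Aᵀ * A) * modelMatrix X)) := by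
  set Q := (modelMatrix X)ᵀ * (Aᵀ * A) * modelMatrix X
  have hQ : ∀ i j, Q i j = Q j i := by
    have : Q.IsSymm := by simp [Q, IsSymm, Matrix.mul_assoc]
    exact fun i j => this.apply j i
  have hvar : ∀ i, ∫ ω, modelVector (β ω) (u ω) i ^ 2 ∂P =
      Sum.elim (fun _ => σ ^ 2) (fun _ => τ ^ 2) i := by
    rintro (i | j)
    · simpa [modelVector] using h.noise_sq i
    · simpa [modelVector] using h.effect_sq j
  obtain ⟨h1, h2⟩ := h.centered.integral_quadForm_sq_le Q hQ Finset.univ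
  have e : ∀ ω, c * sqNorm (A *ᵥ response X (β ω) (u ω)) - c * (σ ^ 2 * (Aᵀ * A).trace
      + τ ^ 2 * ((p : ℝ)⁻¹ * (X * Xᵀ * (Aᵀ * A)).trace)) =
      c * (∑ i, ∑ j, Q i j * modelVector (β ω) (u ω) i * modelVector (β ω) (u ω) j
        - ∑ i, Q i i * ∫ ω, modelVector (β ω) (u ω) i ^ 2 ∂P) := by
    intro ω
    simp_rw [hvar]
    rw [trace_weighted_model, ← modelMatrix_mulVec hp, sqNorm_mulVec_eq]
    ring
  simp_rw [e, mul_pow]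
  refine ⟨h1.integrable_sq.const_mul _, ?_⟩
  rw [integral_const_mul]
  calc _ ≤ c ^ 2 * (8 * M ^ 2 * ∑ i, ∑ j, Q i j ^ 2) :=
        mul_le_mul_of_nonneg_left h2 (sq_nonneg c)
    _ = _ := by rw [frobSq]; ring

theorem ModelNoise.integral_devNorm_sq_le (h : ModelNoise β u P σ τ M) (hn : 0 < n) (hp : 0 < p)
    (X : Matrix (Fin n) (Fin p) ℝ) :
    Integrable (fun ω => devNorm σ τ X (response X (β ω) (u ω)) ^ 2) P ∧
    ∫ ω, devNorm σ τ X (response X (β ω) (u ω)) ^ 2 ∂P ≤ 16 * M ^ 2 * designFluct X := by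
  have key := h.integral_sqNorm_sub_sq_le hp X (1 : Matrix (Fin n) (Fin n) ℝ) (n : ℝ)⁻¹
  have e : ∀ y, devNorm σ τ X y = (n : ℝ)⁻¹ * sqNorm ((1 : Matrix (Fin n) (Fin n) ℝ) *ᵥ y) -
      (n : ℝ)⁻¹ * (σ ^ 2 * ((1 : Matrix (Fin n) (Fin n) ℝ)ᵀ * 1).trace +
        τ ^ 2 * ((p : ℝ)⁻¹ * (X * Xᵀ * ((1 : Matrix (Fin n) (Fin n) ℝ)ᵀ * 1)).trace)) := by
    intro y
    rw [devNorm, mHat1_eq]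
    simp only [one_mulVec, transpose_one, Matrix.mul_one, trace_one, Fintype.card_fin]
    field_simp
  simp_rw [e]
  refine ⟨key.1, key.2.trans ?_⟩
  have := frobSq_model_one_le hn X
  rw [transpose_one, Matrix.mul_one (1 : Matrix (Fin n) (Fin n) ℝ)]
  calc _ ≤ 8 * M ^ 2 * ((n : ℝ)⁻¹ ^ 2 * (2 * n ^ 2 * designFluct X)) := by
        gcongr
        exact this
    _ = _ := by field_simp; ring

theorem ModelNoise.integral_devGram_sq_le (h : ModelNoise β u P σ τ M) (hn : 0 < n) (hp : 0 < p)
    (X : Matrix (Fin n) (Fin p) ℝ) :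
    Integrable (fun ω => devGram σ τ X (response X (β ω) (u ω)) ^ 2) P ∧
    ∫ ω, devGram σ τ X (response X (β ω) (u ω)) ^ 2 ∂P ≤ 16 * M ^ 2 * designFluct X := by
  have key := h.integral_sqNorm_sub_sq_le hp X Xᵀ ((n : ℝ)⁻¹ ^ 2)
  have e : ∀ y, devGram σ τ X y = (n : ℝ)⁻¹ ^ 2 * sqNorm (Xᵀ *ᵥ y) -
      (n : ℝ)⁻¹ ^ 2 * (σ ^ 2 * (Xᵀᵀ * Xᵀ).trace +
        τ ^ 2 * ((p : ℝ)⁻¹ * (X * Xᵀ * (Xᵀᵀ * Xᵀ)).trace)) := by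
    intro y
    have hF : frobSq (X * Xᵀ) = (X * Xᵀ * (X * Xᵀ)).trace := by
      rw [frobSq_eq_trace, transpose_mul, transpose_transpose]
    rw [devGram, mHat1_eq, mHat2_eq, hF, transpose_transpose]
    field_simp
  simp_rw [e]
  refine ⟨key.1, key.2.trans ?_⟩
  have := frobSq_model_gram_le hn X
  rw [transpose_transpose]
  calc _ ≤ 8 * M ^ 2 * (((n : ℝ)⁻¹ ^ 2) ^ 2 * (2 * n ^ 4 * designFluct X)) := by
        gcongr
        exact this
    _ = _ := by field_simp; ring

/-! ### Measurability of the statistics -/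

section Measurability

variable {α ι κ μ : Type*} [MeasurableSpace α] [Fintype ι] [Fintype κ]

theorem measurable_matrix_mul_apply {A : α → Matrix ι κ ℝ} {B : α → Matrix κ μ ℝ}
    (hA : ∀ i k, Measurable fun x => A x i k) (hB : ∀ k j, Measurable fun x => B x k j)
    (i : ι) (j : μ) : Measurable fun x => (A x * B x) i j := by
  simp only [mul_apply]
  fun_prop

theorem measurable_mulVec_apply {A : α → Matrix ι κ ℝ} {v : α → κ → ℝ}
    (hA : ∀ i k, Measurable fun x => A x i k) (hv : ∀ k, Measurable fun x => v x k) (i : ι) :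
    Measurable fun x => (A x *ᵥ v x) i := by
  simp only [mulVec, dotProduct]
  fun_prop

theorem measurable_sqNorm {k : ℕ} {v : α → Fin k → ℝ} (hv : ∀ i, Measurable fun x => v x i) :
    Measurable fun x => sqNorm (v x) := by
  simp only [sqNorm]
  fun_prop

theorem measurable_frobSq {A : α → Matrix ι κ ℝ} (hA : ∀ i k, Measurable fun x => A x i k) :
    Measurable fun x => frobSq (A x) := by
  simp only [frobSq]
  fun_prop

theorem measurable_design (S : Matrix (Fin p) (Fin p) ℝ) (i : Fin n) (j : Fin p) :
    Measurable fun z : Fin n → Fin p → ℝ => design z S i j :=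
  measurable_matrix_mul_apply (A := fun z => of z) (B := fun _ => psdSqrt S)
    (fun i k => (measurable_pi_apply k).comp (measurable_pi_apply i))
    (fun _ _ => measurable_const) i j

theorem measurable_gram (S : Matrix (Fin p) (Fin p) ℝ) (i j : Fin n) :
    Measurable fun z : Fin n → Fin p → ℝ => (design z S * (design z S)ᵀ) i j :=
  measurable_matrix_mul_apply (measurable_design S) (fun k j => measurable_design S j k) i j

theorem measurable_designFluct (S : Matrix (Fin p) (Fin p) ℝ) :
    Measurable fun z : Fin n → Fin p → ℝ => designFluct (design z S) :=
  (((measurable_frobSq (measurable_matrix_mul_apply (measurable_gram S)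
    (measurable_gram S))).div_const _).const_add _).const_mul _

theorem measurable_mHat1 (S : Matrix (Fin p) (Fin p) ℝ) :
    Measurable fun z : Fin n → Fin p → ℝ => mHat1 (design z S) := by
  simp only [mHat1_eq]
  exact (Finset.measurable_sum _ fun i _ => measurable_gram S i i).div_const _

theorem measurable_mHat2 (S : Matrix (Fin p) (Fin p) ℝ) :
    Measurable fun z : Fin n → Fin p → ℝ => mHat2 (design z S) := by
  simp only [mHat2_eq]
  exact (measurable_frobSq (measurable_gram S)).div_const _

variable {S : Matrix (Fin p) (Fin p) ℝ} {z : α → Fin n → Fin p → ℝ} {b : α → Fin p → ℝ}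
  {e : α → Fin n → ℝ}

theorem measurable_response (hz : Measurable z) (hb : Measurable b) (he : Measurable e)
    (i : Fin n) : Measurable fun x => response (design (z x) S) (b x) (e x) i :=
  (measurable_mulVec_apply (fun i k => (measurable_design S i k).comp hz)
    (fun k => (measurable_pi_apply k).comp hb) i).add ((measurable_pi_apply i).comp he)

theorem measurable_devNorm (hz : Measurable z) (hb : Measurable b) (he : Measurable e) :
    Measurable fun x =>
      devNorm σ τ (design (z x) S) (response (design (z x) S) (b x) (e x)) :=
  ((measurable_sqNorm (measurable_response hz hb he)).div_const _).sub
    ((((measurable_mHat1 S).comp hz).const_mul _).const_add _)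

theorem measurable_devGram (hz : Measurable z) (hb : Measurable b) (he : Measurable e) :
    Measurable fun x =>
      devGram σ τ (design (z x) S) (response (design (z x) S) (b x) (e x)) :=
  ((measurable_sqNorm (measurable_mulVec_apply
    (A := fun x => (design (z x) S)ᵀ) (fun i k => (measurable_design S k i).comp hz)
    (measurable_response hz hb he))).div_const _).sub
    (((((measurable_mHat1 S).comp hz).const_mul _).const_mul _).add
      (((measurable_mHat2 S).comp hz).const_mul _))

end Measurability

/-- The errors of the estimators in terms of the deviations of the quadratic statistics. -/
theorem tauSqHat_sub_eq (X : Matrix (Fin n) (Fin p) ℝ) (y : Fin n → ℝ) (h : mTilde2 X ≠ 0) :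
    tauSqHat X y - τ ^ 2 =
      (devGram σ τ X y - (p : ℝ) / n * mHat1 X * devNorm σ τ X y) / mTilde2 X := by
  rw [eq_div_iff h, tauSqHat, devGram, devNorm]
  have e : mTilde2 X = mHat2 X - (p : ℝ) / n * mHat1 X ^ 2 := rfl
  have h2 : mHat2 X = mTilde2 X + (p : ℝ) / n * mHat1 X ^ 2 := by rw [e]; ring
  rw [h2]
  generalize (p : ℝ) / n = r
  generalize sqNorm y / n = a
  generalize sqNorm (Xᵀ *ᵥ y) / (n : ℝ) ^ 2 = b
  field_simp
  ring

/-- The noise estimator is `‖y‖²/n - m̂₁ τ̂²`, the first moment equation solved for `σ²`. The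
identity survives division by zero, so `m̃₂ ≠ 0` is not required. -/
theorem sigmaSqHat_sub_eq (X : Matrix (Fin n) (Fin p) ℝ) (y : Fin n → ℝ) :
    sigmaSqHat X y - σ ^ 2 = devNorm σ τ X y - mHat1 X * (tauSqHat X y - τ ^ 2) := by
  rw [sigmaSqHat, devNorm, tauSqHat]
  ring

end Model

/-! ### Asymptotics with `p` of order `n` -/

section HighDimension

open Matrix

variable {Ω : Type*} [MeasurableSpace Ω] {P : Measure Ω} [IsProbabilityMeasure P]
  {p : ℕ → ℕ} {S : (n : ℕ) → Matrix (Fin (p n)) (Fin (p n)) ℝ}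
  {Z : (n : ℕ) → Ω → Fin n → Fin (p n) → ℝ} {C M Γ : ℝ}

/-- A sequence of standardized designs with bounded aspect ratio and bounded covariances. -/
structure DesignSeq (p : ℕ → ℕ) (S : (n : ℕ) → Matrix (Fin (p n)) (Fin (p n)) ℝ)
    (Z : (n : ℕ) → Ω → Fin n → Fin (p n) → ℝ) (P : Measure Ω) (C M Γ : ℝ) : Prop where
  std : ∀ n, 2 ≤ n → StdEntries (Z n) P M
  psd : ∀ n, 2 ≤ n → (S n).PosSemidef
  opBound : ∀ n, 2 ≤ n → OpBound (S n) C
  dim_pos : ∀ n, 2 ≤ n → 0 < p n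
  dim_le : ∀ᶠ n in atTop, (p n : ℝ) ≤ Γ * n
  le_dim : ∀ᶠ n : ℕ in atTop, (n : ℝ) ≤ Γ * p n

namespace DesignSeq

/-- The mean of the sum is `O(n p) = O(n²)`, one power of `n` below the normalization. -/
theorem likely_diag_le (h : DesignSeq p S Z P C M Γ) {η : ℝ} (hη : 0 < η) :
    Likely P fun n ω =>
      (∑ i, (rowForm (S n) (Z n ω) i i - (S n).trace) ^ 2) / (n : ℝ) ^ 3 ≤ η := by
  refine Likely.of_integral_le (K := 8 * M ^ 2 * C ^ 2 * Γ) (fun n ω => by positivity) ?_ hη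
  filter_upwards [h.dim_le, eventually_ge_atTop 2] with n hpn hn
  obtain ⟨h1, h2⟩ := (h.std n hn).integral_sum_rowForm_diag_le (h.psd n hn).isSymm (h.opBound n hn)
  have hn0 : (0 : ℝ) < n := by positivity
  refine ⟨h1.div_const _, ?_⟩
  rw [integral_div, div_le_div_iff₀ (by positivity) hn0]
  calc _ ≤ n * (8 * M ^ 2 * (C ^ 2 * p n)) * n := by gcongr
    _ ≤ n * (8 * M ^ 2 * (C ^ 2 * (Γ * n))) * n := by gcongr
    _ = _ := by ring

/-- The mean is `O(n³ p² + n⁴ p) = O(n⁵)`, again one power short. -/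
theorem likely_schatten_le (h : DesignSeq p S Z P C M Γ) {η : ℝ} (hη : 0 < η) :
    Likely P fun n ω => (∑ i, ∑ k, (∑ j, offForm (S n) (Z n ω) i j
      * offForm (S n) (Z n ω) j k) ^ 2) / (n : ℝ) ^ 6 ≤ η := by
  refine Likely.of_integral_le (K := 6 * M ^ 4 * C ^ 4 * Γ ^ 2 + C ^ 4 * Γ)
    (fun n ω => by positivity) ?_ hη
  filter_upwards [h.dim_le, eventually_ge_atTop 2] with n hpn hn
  obtain ⟨h1, h2⟩ := (h.std n hn).integral_offForm_schatten_le (h.psd n hn).isSymm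
    (h.opBound n hn)
  have hn0 : (0 : ℝ) < n := by positivity
  refine ⟨h1.div_const _, ?_⟩
  rw [integral_div, div_le_div_iff₀ (by positivity) hn0]
  calc _ ≤ (2 * n ^ 3 * (3 * M ^ 4 * C ^ 4 * p n ^ 2) + n ^ 4 * (C ^ 4 * p n)) * n := by gcongr
    _ ≤ (2 * n ^ 3 * (3 * M ^ 4 * C ^ 4 * (Γ * n) ^ 2) + n ^ 4 * (C ^ 4 * (Γ * n))) * n := by
        gcongr
    _ = _ := by ring

theorem likely_offDiag_near (h : DesignSeq p S Z P C M Γ) {η : ℝ} (hη : 0 < η) :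
    Likely P fun n ω => (∑ i, ∑ j, offForm (S n) (Z n ω) i j ^ 2
      - n * (n - 1) * frobSq (S n)) ^ 2 / ((n : ℝ) ^ 2 * p n) ^ 2 ≤ η := by
  refine Likely.of_integral_le (K := 12 * M ^ 4 * C ^ 4) (fun n ω => by positivity) ?_ hη
  filter_upwards [eventually_ge_atTop 2] with n hn
  obtain ⟨h1, h2⟩ := (h.std n hn).integral_sum_offForm_sq_sub_le (h.opBound n hn)
  have hn0 : (0 : ℝ) < n := by positivity
  have hp0 : (0 : ℝ) < p n := by exact_mod_cast h.dim_pos n hn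
  refine ⟨h1.div_const _, ?_⟩
  rw [integral_div, div_le_div_iff₀ (by positivity) hn0]
  calc _ ≤ 4 * n ^ 3 * (3 * M ^ 4 * C ^ 4 * p n ^ 2) * (n : ℝ) := by gcongr
    _ = _ := by ring

/-- Boundedness is all that the error formulas require, so the diagonal deviations may be as large
as `n³` in total. -/
theorem likely_mHat1_le (h : DesignSeq p S Z P C M Γ) :
    Likely P fun n ω => mHat1 (design (Z n ω) (S n)) ^ 2 ≤ 2 * C ^ 2 + 2 * Γ ^ 2 := by
  refine (h.likely_diag_le one_pos).mono ?_
  filter_upwards [h.le_dim, eventually_ge_atTop 2] with n hnp hn ω hω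
  have hn0 : (0 : ℝ) < n := by positivity
  have hp0 : (0 : ℝ) < p n := by exact_mod_cast h.dim_pos n hn
  have h1 := trace_gram_sq_le (h.opBound n hn) (Z n ω)
  rw [mHat1_eq, design_mul_transpose (h.psd n hn), div_pow, div_le_iff₀ (by positivity)]
  rw [div_le_one (by positivity)] at hω
  change (∑ i, rowForm (S n) (Z n ω) i i) ^ 2 ≤ _
  calc _ ≤ 2 * n * (n * (C ^ 2 * p n ^ 2) + (n : ℝ) ^ 3) := h1.trans (by gcongr)
    _ = 2 * C ^ 2 * (n * p n) ^ 2 + 2 * (n : ℝ) ^ 2 * n ^ 2 := by ring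
    _ ≤ 2 * C ^ 2 * (n * p n) ^ 2 + 2 * (n : ℝ) ^ 2 * (Γ * p n) ^ 2 := by gcongr
    _ = _ := by ring

theorem likely_le_mTilde2 (h : DesignSeq p S Z P C M Γ) {c : ℝ} (hc : 0 < c)
    (hcS : ∀ᶠ n in atTop, c * p n ≤ frobSq (S n)) :
    Likely P fun n ω => c / 4 ≤ mTilde2 (design (Z n ω) (S n)) := by
  -- As `n (n - 1) ≥ n² / 2`, the centering is at least `(c / 2) n² p`; a deviation of at most `(c /
  -- 4) n² p` leaves `c / 4` after normalization.
  refine (h.likely_offDiag_near (η := (c / 4) ^ 2) (by positivity)).mono ?_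
  filter_upwards [hcS, eventually_ge_atTop 2] with n hSn hn ω hω
  have hn2 : (2 : ℝ) ≤ n := by exact_mod_cast hn
  have hn0 : (0 : ℝ) < n := by positivity
  have hp0 : (0 : ℝ) < p n := by exact_mod_cast h.dim_pos n hn
  refine le_trans ?_ (sum_sq_offDiag_le_mTilde2 (by omega) (h.dim_pos n hn) _)
  rw [design_mul_transpose (h.psd n hn), le_div_iff₀ (by positivity)]
  change _ ≤ ∑ i, ∑ j, offForm (S n) (Z n ω) i j ^ 2
  rw [← div_pow] at hω
  have h1 := (abs_le_of_sq_le_sq' hω (by positivity)).1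
  rw [le_div_iff₀ (by positivity)] at h1
  have h2 : (n : ℝ) * (n - 1) * (c * p n) ≤ n * (n - 1) * frobSq (S n) :=
    mul_le_mul_of_nonneg_left hSn (mul_nonneg hn0.le (by linarith))
  have h3 : (n : ℝ) ^ 2 / 2 * (c * p n) ≤ n * (n - 1) * (c * p n) :=
    mul_le_mul_of_nonneg_right (by nlinarith) (by positivity)
  linarith

theorem likely_designFluct_le (h : DesignSeq p S Z P C M Γ) {η : ℝ} (hη : 0 < η) :
    Likely P fun n ω => designFluct (design (Z n ω) (S n)) ≤ η := by
  -- `L` collects the constants once `1 / n` and the two normalized sums are at most `θ`; the cap `θ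
  -- ≤ 1` lets the squared diagonal term be bounded by `θ` as well.
  set L : ℝ := (1 + Γ ^ 2) * (1 + 64 * (C ^ 4 * Γ ^ 4 + 1) + 8) with hL
  have hL0 : 0 < L := by positivity
  set θ : ℝ := min 1 (η / L)
  have hθ0 : 0 < θ := lt_min one_pos (by positivity)
  have hθ1 : θ ≤ 1 := min_le_left _ _
  have hθη : L * θ ≤ η := by
    have : θ ≤ η / L := min_le_right _ _
    rwa [le_div_iff₀' hL0] at this
  have hinv : ∀ᶠ n : ℕ in atTop, 1 / (n : ℝ) ≤ θ :=
    (tendsto_const_div_atTop_nhds_zero_nat (1 : ℝ)).eventually_le_const hθ0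
  refine ((h.likely_diag_le hθ0).and (h.likely_schatten_le hθ0)).mono ?_
  filter_upwards [h.dim_le, h.le_dim, hinv, eventually_ge_atTop 2] with n hpn hnp hni hn ω hω
  obtain ⟨h1, h2⟩ := hω
  have hn0 : (0 : ℝ) < n := by positivity
  have hp0 : (0 : ℝ) < p n := by exact_mod_cast h.dim_pos n hn
  have hG := frobSq_gram_sq_le (h.psd n hn).isSymm (h.opBound n hn) (Z n ω)
  set d := ∑ i, (rowForm (S n) (Z n ω) i i - (S n).trace) ^ 2
  have hd : 0 ≤ d := Finset.sum_nonneg fun _ _ => sq_nonneg _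
  set ψ := ∑ i, ∑ k, (∑ j, offForm (S n) (Z n ω) i j * offForm (S n) (Z n ω) j k) ^ 2
  rw [designFluct, design_mul_transpose (h.psd n hn)]
  set F := frobSq ((of fun i j => rowForm (S n) (Z n ω) i j) *
    (of fun i j => rowForm (S n) (Z n ω) i j))
  have hnp' : (n / p n : ℝ) ≤ Γ := (div_le_iff₀ hp0).2 hnp
  have hpn' : (p n / n : ℝ) ≤ Γ := (div_le_iff₀ hn0).2 hpn
  have hF : F / n ^ 6 ≤ 64 * (C ^ 4 * Γ ^ 4 * θ + θ) + 8 * θ := by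
    have e : (64 * (n * (C ^ 4 * p n ^ 4) + d ^ 2) + 8 * ψ) / (n : ℝ) ^ 6 =
        64 * (C ^ 4 * (p n / n : ℝ) ^ 4 * (1 / n) + (d / n ^ 3) ^ 2) + 8 * (ψ / n ^ 6) := by
      field_simp
    calc F / n ^ 6 ≤ (64 * (n * (C ^ 4 * p n ^ 4) + d ^ 2) + 8 * ψ) / (n : ℝ) ^ 6 := by gcongr
      _ = _ := e
      _ ≤ 64 * (C ^ 4 * Γ ^ 4 * θ + θ ^ 2) + 8 * θ := by gcongr
      _ ≤ _ := by
        have : θ ^ 2 ≤ θ := by nlinarith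
        linarith
  have hF0 : 0 ≤ F / (n : ℝ) ^ 6 := div_nonneg (frobSq_nonneg _) (by positivity)
  calc (1 + (n / p n : ℝ) ^ 2) * (1 / n + F / n ^ 6)
      ≤ (1 + Γ ^ 2) * (θ + (64 * (C ^ 4 * Γ ^ 4 * θ + θ) + 8 * θ)) := by gcongr
    _ = L * θ := by rw [hL]; ring
    _ ≤ η := hθη

variable {β : (n : ℕ) → Ω → Fin (p n) → ℝ} {u : (n : ℕ) → Ω → Fin n → ℝ} {σ τ N : ℝ}

/-- Both quadratic statistics concentrate around their conditional means given the design. -/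
theorem likely_dev_lt (h : DesignSeq p S Z P C M Γ)
    (hnoise : ∀ n, 2 ≤ n → ModelNoise (β n) (u n) P σ τ N)
    (hum : ∀ n, 2 ≤ n → Measurable (u n)) (hβm : ∀ n, 2 ≤ n → Measurable (β n))
    (hind : ∀ n, 2 ≤ n → IndepFun (fun ω => (u n ω, β n ω)) (Z n) P) {κ : ℝ} (hκ : 0 < κ) :
    Likely P fun n ω =>
      |devNorm σ τ (design (Z n ω) (S n)) (response (design (Z n ω) (S n)) (β n ω) (u n ω))| < κ ∧
      |devGram σ τ (design (Z n ω) (S n)) (response (design (Z n ω) (S n)) (β n ω) (u n ω))|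
        < κ := by
  have hZm : ∀ n, 2 ≤ n → Measurable (Z n) := fun n hn =>
    measurable_pi_iff.2 fun i => (h.std n hn).measurable_row i
  refine Likely.and ?_ ?_
  · refine Likely.abs_lt_of_le (K := 16 * N ^ 2) (by positivity) ?_
      (fun η hη => h.likely_designFluct_le hη) hκ
    filter_upwards [eventually_ge_atTop 2] with n hn η hη κ hκ
    -- The noise and effects are averaged with `Z` frozen, so `designFluct` plays the role of the
    -- conditional variance.
    exact measureReal_not_abs_lt_le (hind n hn) ((hum n hn).prodMk (hβm n hn)) (hZm n hn)
      (φ := fun x z => devNorm σ τ (design z (S n)) (response (design z (S n)) x.2 x.1))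
      (measurable_devNorm (by fun_prop) (by fun_prop) (by fun_prop))
      (measurable_designFluct (S n)) (by positivity)
      (fun z => (hnoise n hn).integral_devNorm_sq_le (by omega) (h.dim_pos n hn) _) hη hκ
  · refine Likely.abs_lt_of_le (K := 16 * N ^ 2) (by positivity) ?_
      (fun η hη => h.likely_designFluct_le hη) hκ
    filter_upwards [eventually_ge_atTop 2] with n hn η hη κ hκ
    exact measureReal_not_abs_lt_le (hind n hn) ((hum n hn).prodMk (hβm n hn)) (hZm n hn)
      (φ := fun x z => devGram σ τ (design z (S n)) (response (design z (S n)) x.2 x.1))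
      (measurable_devGram (by fun_prop) (by fun_prop) (by fun_prop))
      (measurable_designFluct (S n)) (by positivity)
      (fun z => (hnoise n hn).integral_devGram_sq_le (by omega) (h.dim_pos n hn) _) hη hκ

/-- Joint consistency of the two moment estimators. -/
theorem likely_estimators_near (h : DesignSeq p S Z P C M Γ)
    (hnoise : ∀ n, 2 ≤ n → ModelNoise (β n) (u n) P σ τ N)
    (hum : ∀ n, 2 ≤ n → Measurable (u n)) (hβm : ∀ n, 2 ≤ n → Measurable (β n))
    (hind : ∀ n, 2 ≤ n → IndepFun (fun ω => (u n ω, β n ω)) (Z n) P)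
    {c : ℝ} (hc : 0 < c) (hcS : ∀ᶠ n in atTop, c * p n ≤ frobSq (S n)) {δ : ℝ} (hδ : 0 < δ) :
    Likely P fun n ω =>
      |sigmaSqHat (design (Z n ω) (S n)) (response (design (Z n ω) (S n)) (β n ω) (u n ω))
        - σ ^ 2| < δ ∧
      |tauSqHat (design (Z n ω) (S n)) (response (design (Z n ω) (S n)) (β n ω) (u n ω))
        - τ ^ 2| < δ := by
  set B : ℝ := √(2 * C ^ 2 + 2 * Γ ^ 2)
  have hB : 0 ≤ B := Real.sqrt_nonneg _
  set L : ℝ := (1 + |Γ| * B) / (c / 4)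
  have hL : 0 ≤ L := by positivity
  -- `B` bounds `|m̂₁|`, and `L` is the amplification caused by dividing by `m̃₂ ≥ c / 4`. The
  -- errors are at most `κ L` for `τ̂²` and `κ + B κ L` for `σ̂²`, both bounded by `κ (1 + L + B L)
  -- = δ / 2`.
  set κ : ℝ := δ / (2 * (1 + L + B * L))
  have hκ : 0 < κ := by positivity
  have hκδ : κ * (1 + L + B * L) < δ := by
    have : κ * (1 + L + B * L) = δ / 2 := by simp only [κ]; field_simp
    linarith
  refine (((h.likely_dev_lt hnoise hum hβm hind hκ).and (h.likely_mHat1_le)).and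
    (h.likely_le_mTilde2 hc hcS)).mono ?_
  filter_upwards [h.dim_le, eventually_ge_atTop 2] with n hpn hn ω hω
  obtain ⟨⟨⟨h1, h2⟩, h3⟩, h4⟩ := hω
  have hn0 : (0 : ℝ) < n := by positivity
  set X := design (Z n ω) (S n)
  set y := response X (β n ω) (u n ω)
  have hm : 0 < mTilde2 X := lt_of_lt_of_le (by positivity) h4
  have hm1 : |mHat1 X| ≤ B := Real.abs_le_sqrt h3
  have hr : |(p n / n : ℝ)| ≤ |Γ| := by
    rw [abs_of_nonneg (by positivity)]
    exact ((div_le_iff₀ hn0).2 hpn).trans (le_abs_self Γ)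
  have hτ : |tauSqHat X y - τ ^ 2| ≤ κ * L := by
    rw [tauSqHat_sub_eq X y hm.ne', abs_div, abs_of_pos hm]
    calc |devGram σ τ X y - (p n / n : ℝ) * mHat1 X * devNorm σ τ X y| / mTilde2 X
        ≤ (κ + |Γ| * B * κ) / (c / 4) := by
          gcongr
          refine (abs_sub _ _).trans (add_le_add h2.le ?_)
          rw [abs_mul, abs_mul]
          gcongr
      _ = κ * L := by simp only [L]; ring
  have hσ : |sigmaSqHat X y - σ ^ 2| ≤ κ + B * (κ * L) := by
    rw [sigmaSqHat_sub_eq (τ := τ)]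
    refine (abs_sub _ _).trans (add_le_add h1.le ?_)
    rw [abs_mul]
    gcongr
  have hκL : 0 ≤ κ * L := by positivity
  have hBκL : 0 ≤ B * (κ * L) := by positivity
  constructor
  · refine hσ.trans_lt (lt_of_le_of_lt ?_ hκδ)
    linarith
  · refine hτ.trans_lt (lt_of_le_of_lt ?_ hκδ)
    linarith

end DesignSeq

end HighDimension

/-! ### From the moment assumptions to the working hypotheses -/

section Hypotheses

open Matrix

variable {Ω : Type*} [MeasurableSpace Ω] {P : Measure Ω} [IsProbabilityMeasure P] {n p : ℕ}

/-- Moments of order four from moments of a higher order. -/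
theorem integral_pow_four_le_of_rpow {f : Ω → ℝ} (hf : Measurable f) {ε K : ℝ} (hε : 0 < ε)
    (h : Integrable (fun ω => |f ω| ^ (4 + ε)) P ∧ ∫ ω, |f ω| ^ (4 + ε) ∂P ≤ K) :
    Integrable (fun ω => f ω ^ 4) P ∧ ∫ ω, f ω ^ 4 ∂P ≤ 1 + K := by
  have hle : ∀ ω, f ω ^ 4 ≤ 1 + |f ω| ^ (4 + ε) := by
    intro ω
    have h4 : f ω ^ 4 = |f ω| ^ (4 : ℝ) := by
      rw [show (4 : ℝ) = ((4 : ℕ) : ℝ) by norm_num, Real.rpow_natCast, Even.pow_abs (by decide)]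
    have h0 : 0 ≤ |f ω| ^ (4 + ε) := by positivity
    rcases le_total |f ω| 1 with h1 | h1
    · rw [h4]
      linarith [Real.rpow_le_one (abs_nonneg (f ω)) h1 (show (0 : ℝ) ≤ 4 by norm_num)]
    · rw [h4]
      linarith [Real.rpow_le_rpow_of_exponent_le h1 (show (4 : ℝ) ≤ 4 + ε by linarith)]
  have hi1 := (integrable_const (1 : ℝ)).fun_add h.1
  have hi : Integrable (fun ω => f ω ^ 4) P := by
    refine hi1.mono' (by fun_prop) (ae_of_all _ fun ω => ?_)
    rw [Real.norm_of_nonneg (by positivity)]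
    exact hle ω
  refine ⟨hi, (integral_mono hi hi1 hle).trans ?_⟩
  rw [integral_add (integrable_const _) h.1]
  simpa using h.2

theorem stdEntries_of_moments {Z : Ω → Fin n → Fin p → ℝ}
    (hm : ∀ i j, Measurable fun ω => Z ω i j)
    (hind : iIndepFun (fun (ij : Fin n × Fin p) ω => Z ω ij.1 ij.2) P)
    (h1 : ∀ i j, ∫ ω, Z ω i j ∂P = 0) (h2 : ∀ i j, ∫ ω, Z ω i j ^ 2 ∂P = 1) {K : ℝ}
    (h4 : ∀ i j, Integrable (fun ω => Z ω i j ^ 4) P ∧ ∫ ω, Z ω i j ^ 4 ∂P ≤ K) :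
    StdEntries Z P (1 + |K|) where
  entries :=
    { meas := fun ij => hm ij.1 ij.2
      indep := hind
      memLp := fun ij => (memLp_four_iff_integrable_pow
        (hm ij.1 ij.2).aestronglyMeasurable).2 (h4 ij.1 ij.2).1
      mean := fun ij => h1 ij.1 ij.2
      sq_le := fun ij => by rw [h2]; linarith [abs_nonneg K]
      pow_le := fun ij => (h4 ij.1 ij.2).2.trans (by nlinarith [abs_nonneg K, le_abs_self K]) }
  var_one := h2

/-- Scaling by `√p` brings the effects, with variance `τ²/p` and fourth moment `O(p⁻²)`, to the
scale of the noise. The final constant is at least 1, so it is below its own square and serves for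
both the second and the fourth moments. -/
theorem modelNoise_of_moments (hp : 0 < p) {β : Ω → Fin p → ℝ} {u : Ω → Fin n → ℝ}
    {σ τ νβ νu : ℝ}
    (hβm : ∀ i, Measurable fun ω => β ω i) (hβind : iIndepFun (fun i ω => β ω i) P)
    (hβ1 : ∀ i, ∫ ω, β ω i ∂P = 0) (hβ2 : ∀ i, ∫ ω, β ω i ^ 2 ∂P = (p : ℝ)⁻¹ * τ ^ 2)
    (hβ4 : ∀ i, Integrable (fun ω => β ω i ^ 4) P ∧ (p : ℝ) ^ 2 * ∫ ω, β ω i ^ 4 ∂P ≤ νβ)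
    (hum : ∀ i, Measurable fun ω => u ω i) (huind : iIndepFun (fun i ω => u ω i) P)
    (hu1 : ∀ i, ∫ ω, u ω i ∂P = 0) (hu2 : ∀ i, ∫ ω, u ω i ^ 2 ∂P = σ ^ 2)
    (hu4 : ∀ i, Integrable (fun ω => u ω i ^ 4) P ∧ ∫ ω, u ω i ^ 4 ∂P ≤ νu)
    (hind : IndepFun u β P) :
    ModelNoise β u P σ τ (1 + σ ^ 2 + τ ^ 2 + |νu| + |νβ|) := by
  have hp0 : (0 : ℝ) < p := by exact_mod_cast hp
  have hsq : √(p : ℝ) ^ 2 = p := Real.sq_sqrt hp0.le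
  have hβ2' : ∀ j, ∫ ω, (√(p : ℝ) * β ω j) ^ 2 ∂P = τ ^ 2 := by
    intro j
    simp_rw [mul_pow, hsq]
    rw [integral_const_mul, hβ2]
    field_simp
  have hβ4' : ∀ j, ∫ ω, (√(p : ℝ) * β ω j) ^ 4 ∂P ≤ νβ := by
    intro j
    have : √(p : ℝ) ^ 4 = (p : ℝ) ^ 2 := by
      rw [show √(p : ℝ) ^ 4 = (√(p : ℝ) ^ 2) ^ 2 by ring, hsq]
    simp_rw [mul_pow, this]
    rw [integral_const_mul]
    exact (hβ4 j).2
  set N := 1 + σ ^ 2 + τ ^ 2 + |νu| + |νβ| with hN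
  have a1 := abs_nonneg νu
  have a2 := abs_nonneg νβ
  have a3 := sq_nonneg σ
  have a4 := sq_nonneg τ
  have hN1 : 1 ≤ N := by linarith
  have hNsq : N ≤ N ^ 2 := by nlinarith
  have hfun : (fun i ω => modelVector (β ω) (u ω) i) =
      Sum.elim (fun i ω => u ω i) (fun j ω => √(p : ℝ) * β ω j) := by
    ext i ω
    rcases i with i | j <;> simp [modelVector]
  refine ⟨?_, hu2, hβ2'⟩
  rw [hfun]
  constructor
  · rintro (i | j)
    · exact hum i
    · exact (hβm j).const_mul _
  · refine iIndepFun.sumElim huind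
      (hβind.comp (fun _ x => √(p : ℝ) * x) fun _ => measurable_const_mul _) ?_
    exact hind.comp (φ := fun x => x) (ψ := fun x : Fin p → ℝ => fun j => √(p : ℝ) * x j)
      measurable_id (by fun_prop)
  · rintro (i | j)
    · exact (memLp_four_iff_integrable_pow (hum i).aestronglyMeasurable).2 (hu4 i).1
    · exact ((memLp_four_iff_integrable_pow (hβm j).aestronglyMeasurable).2 (hβ4 j).1).const_mul _
  · rintro (i | j)
    · exact hu1 i
    · simp only [Sum.elim_inr]
      rw [integral_const_mul, hβ1, mul_zero]
  · rintro (i | j)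
    · simp only [Sum.elim_inl]
      rw [hu2]
      linarith
    · simp only [Sum.elim_inr]
      rw [hβ2']
      linarith
  · rintro (i | j)
    · exact (hu4 i).2.trans (by linarith [le_abs_self νu])
    · exact (hβ4' j).trans (by linarith [le_abs_self νβ])

/-- Pairwise consequences of the joint independence of three random elements. -/
theorem indepFun_of_iIndep_three {α γ δ : Type*} [MeasurableSpace α] [MeasurableSpace γ]
    [MeasurableSpace δ] {X : Ω → α} {Y : Ω → γ} {W : Ω → δ} (hX : Measurable X)
    (hY : Measurable Y) (hW : Measurable W)
    (h : iIndep ![MeasurableSpace.comap X inferInstance, MeasurableSpace.comap Y inferInstance,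
      MeasurableSpace.comap W inferInstance] P) :
    IndepFun X W P ∧ IndepFun (fun ω => (X ω, W ω)) Y P := by
  set m : Fin 3 → MeasurableSpace Ω := ![MeasurableSpace.comap X inferInstance,
    MeasurableSpace.comap Y inferInstance, MeasurableSpace.comap W inferInstance]
  refine ⟨h.indep (i := 0) (j := 2) (by decide), ?_⟩
  have hle : ∀ i, m i ≤ ‹MeasurableSpace Ω› := by
    intro i
    fin_cases i
    · exact hX.comap_le
    · exact hY.comap_le
    · exact hW.comap_le
  have h1 := indep_iSup_of_disjoint hle h (S := {0, 2}) (T := {1}) (by simp)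
  rw [IndepFun_iff_Indep]
  refine indep_of_indep_of_le_left (indep_of_indep_of_le_right h1 ?_) ?_
  · exact le_iSup₂_of_le (f := fun i (_ : i ∈ ({1} : Set (Fin 3))) => m i) 1 rfl le_rfl
  · have hX' : Measurable[⨆ i ∈ ({0, 2} : Set (Fin 3)), m i] X :=
      (comap_measurable X).mono
        (le_iSup₂_of_le (f := fun i (_ : i ∈ ({0, 2} : Set (Fin 3))) => m i) 0 (by simp) le_rfl)
        le_rfl
    have hW' : Measurable[⨆ i ∈ ({0, 2} : Set (Fin 3)), m i] W :=
      (comap_measurable W).mono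
        (le_iSup₂_of_le (f := fun i (_ : i ∈ ({0, 2} : Set (Fin 3))) => m i) 2 (by simp) le_rfl)
        le_rfl
    exact (Measurable.prodMk hX' hW').comap_le

end Hypotheses

/-! ### The consistency theorem -/

theorem theorem3p3
    {Ω : Type*} [MeasurableSpace Ω] (P : Measure Ω) [IsProbabilityMeasure P]
    -- dimensions
    (p : ℕ → ℕ) (hp : ∀ n, 2 ≤ n → 2 ≤ p n)
    (γ : ℝ) (hγ : 0 < γ)
    (hpn : Tendsto (fun n : ℕ => (p n : ℝ) / n) atTop (𝓝 γ))
    -- covariance matrices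
    (S : (n : ℕ) → Matrix (Fin (p n)) (Fin (p n)) ℝ)
    (hS : ∀ n, 2 ≤ n → (S n).PosSemidef)
    (C : ℝ) (hSC : ∀ n, 2 ≤ n → ∀ s ∈ eigs (S n), s ≤ C)
    (hS0 : ∀ n, 2 ≤ n → empSpecDist (S n) 0 ≠ 1)
    -- entries of the matrix `Z`
    (Z : (n : ℕ) → Ω → Fin n → Fin (p n) → ℝ)
    (hZm : ∀ n, 2 ≤ n → ∀ i j, Measurable (fun ω => Z n ω i j))
    (hZind : ∀ n, 2 ≤ n →
      iIndepFun (fun (ij : Fin n × Fin (p n)) ω => Z n ω ij.1 ij.2) P)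
    (hZ1 : ∀ n, 2 ≤ n → ∀ i j, ∫ ω, Z n ω i j ∂P = 0)
    (hZ2 : ∀ n, 2 ≤ n → ∀ i j, ∫ ω, (Z n ω i j) ^ 2 ∂P = 1)
    (ε : ℝ) (hε : 0 < ε) (K : ℝ)
    (hZ4 : ∀ n, 2 ≤ n → ∀ i j,
      Integrable (fun ω => |Z n ω i j| ^ (4 + ε)) P ∧ ∫ ω, |Z n ω i j| ^ (4 + ε) ∂P ≤ K)
    (hZac : ∀ n, 2 ≤ n → ∀ i j, P.map (fun ω => Z n ω i j) ≪ (volume : Measure ℝ))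
    -- limiting spectral distribution, the law of a probability measure on `[0, ∞)`
    (H : Measure ℝ) [IsProbabilityMeasure H] (hHsupp : H (Set.Iio 0) = 0)
    (hHlim : ∀ x : ℝ, ContinuousAt (cdf H) x →
      Tendsto (fun n => empSpecDist (S n) x) atTop (𝓝 (cdf H x)))
    (hH0 : cdf H 0 ≠ 1)
    -- random effects
    (τ : ℝ) (hτ : 0 < τ)
    (β : (n : ℕ) → Ω → Fin (p n) → ℝ)
    (hβm : ∀ n, 2 ≤ n → ∀ i, Measurable (fun ω => β n ω i))
    (hβind : ∀ n, 2 ≤ n → iIndepFun (fun i ω => β n ω i) P)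
    (hβ1 : ∀ n, 2 ≤ n → ∀ i, ∫ ω, β n ω i ∂P = 0)
    (hβ2 : ∀ n, 2 ≤ n → ∀ i, ∫ ω, (β n ω i) ^ 2 ∂P = (p n : ℝ)⁻¹ * τ ^ 2)
    (νβ : ℝ)
    (hβ4 : ∀ n, 2 ≤ n → ∀ i,
      Integrable (fun ω => (β n ω i) ^ 4) P ∧
        (p n : ℝ) ^ 2 * ∫ ω, (β n ω i) ^ 4 ∂P ≤ νβ)
    -- noise
    (σ : ℝ) (hσ : 0 < σ)
    (u : (n : ℕ) → Ω → Fin n → ℝ)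
    (hum : ∀ n, 2 ≤ n → ∀ i, Measurable (fun ω => u n ω i))
    (huind : ∀ n, 2 ≤ n → iIndepFun (fun i ω => u n ω i) P)
    (hu1 : ∀ n, 2 ≤ n → ∀ i, ∫ ω, u n ω i ∂P = 0)
    (hu2 : ∀ n, 2 ≤ n → ∀ i, ∫ ω, (u n ω i) ^ 2 ∂P = σ ^ 2)
    (νu : ℝ)
    (hu4 : ∀ n, 2 ≤ n → ∀ i,
      Integrable (fun ω => (u n ω i) ^ 4) P ∧ ∫ ω, (u n ω i) ^ 4 ∂P ≤ νu)
    -- joint independence of the noise, the matrix `Z` and the random effects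
    (hind : ∀ n, 2 ≤ n →
      iIndep ![MeasurableSpace.comap (u n) inferInstance,
        MeasurableSpace.comap (Z n) inferInstance,
        MeasurableSpace.comap (β n) inferInstance] P) :
    -- the estimators are almost surely well defined
    (∀ n, 2 ≤ n → ∀ᵐ ω ∂P, 0 < mTilde2 (design (Z n ω) (S n))) ∧
    -- consistency
    TendstoInMeasure P
      (fun n ω => sigmaSqHat (design (Z n ω) (S n))
        (response (design (Z n ω) (S n)) (β n ω) (u n ω)))
      atTop (fun _ => σ ^ 2) ∧
    TendstoInMeasure P
      (fun n ω => tauSqHat (design (Z n ω) (S n))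
        (response (design (Z n ω) (S n)) (β n ω) (u n ω)))
      atTop (fun _ => τ ^ 2) := by
  have hp0 : ∀ n, 2 ≤ n → 0 < p n := fun n hn => lt_of_lt_of_le two_pos (hp n hn)
  have hstd : ∀ n, 2 ≤ n → StdEntries (Z n) P (1 + |1 + K|) := fun n hn =>
    stdEntries_of_moments (hZm n hn) (hZind n hn) (hZ1 n hn) (hZ2 n hn) fun i j =>
      integral_pow_four_le_of_rpow (hZm n hn i j) hε (hZ4 n hn i j)
  have hum' : ∀ n, 2 ≤ n → Measurable (u n) := fun n hn => measurable_pi_iff.2 (hum n hn)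
  have hβm' : ∀ n, 2 ≤ n → Measurable (β n) := fun n hn => measurable_pi_iff.2 (hβm n hn)
  have hthree := fun n hn => indepFun_of_iIndep_three (hum' n hn)
    (measurable_pi_iff.2 fun i => (hstd n hn).measurable_row i) (hβm' n hn) (hind n hn)
  have hnoise : ∀ n, 2 ≤ n → ModelNoise (β n) (u n) P σ τ (1 + σ ^ 2 + τ ^ 2 + |νu| + |νβ|) :=
    fun n hn => modelNoise_of_moments (hp0 n hn) (hβm n hn) (hβind n hn) (hβ1 n hn) (hβ2 n hn)
      (hβ4 n hn) (hum n hn) (huind n hn) (hu1 n hn) (hu2 n hn) (hu4 n hn) (hthree n hn).1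
  -- Eventually `γ / 2 ≤ p / n ≤ γ + 1`, so this maximum bounds both `p / n` and `n / p`.
  have hseq : DesignSeq p S Z P C (1 + |1 + K|) (max (γ + 1) (2 / γ)) :=
    { std := hstd
      psd := hS
      opBound := fun n hn => opBound_of_eigs_le (hS n hn) (hSC n hn)
      dim_pos := hp0
      dim_le := by
        filter_upwards [hpn.eventually_le_const (lt_add_one γ), eventually_ge_atTop 2] with n h1 hn
        have hn0 : (0 : ℝ) < n := by positivity
        rw [div_le_iff₀ hn0] at h1
        exact h1.trans (by gcongr; exact le_max_left _ _)
      le_dim := by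
        filter_upwards [hpn.eventually_const_le (half_lt_self hγ), eventually_ge_atTop 2]
          with n h1 hn
        have hn0 : (0 : ℝ) < n := by positivity
        rw [le_div_iff₀ hn0] at h1
        calc (n : ℝ) = 2 / γ * (γ / 2 * n) := by field_simp
          _ ≤ 2 / γ * p n := by gcongr
          _ ≤ _ := by gcongr; exact le_max_right _ _ }
  obtain ⟨c, hc, hcS⟩ := eventually_le_frobSq hp hS hHlim hH0
  have hnear := fun δ (hδ : 0 < δ) =>
    hseq.likely_estimators_near hnoise hum' hβm' (fun n hn => (hthree n hn).2) hc hcS hδ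
  refine ⟨fun n hn => (hstd n hn).ae_mTilde2_pos hn (hp0 n hn) (hS n hn)
    (ne_zero_of_empSpecDist_zero_ne_one (hS n hn) (hp0 n hn) (hS0 n hn)) (hZac n hn), ?_, ?_⟩
  · exact tendstoInMeasure_of_likely fun δ hδ =>
      (hnear δ hδ).mono (Eventually.of_forall fun n ω h => h.1)
  · exact tendstoInMeasure_of_likely fun δ hδ =>
      (hnear δ hδ).mono (Eventually.of_forall fun n ω h => h.2)
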